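/- A (turn-based stochastic) game consists of a finite set of states $S=S_\Diamond\uplus S_\Box$ (controller and environment states), an initial state $\bar s\in S$, a finite set of actions, a non-empty set $A(s)$ of enabled actions for each $s\in S$, and a distribution $\delta(s,a)$ on $S$ for each $s\in S$, $a\in A(s)$. Strategies $\sigma$ of the controller and $\pi$ of the environment are memoryless and may be randomised: they assign to each state $s$ of $S_\Diamond$, respectively $S_\Box$, a distribution on $A(s)$. For $\rho$ assigning values in $[0,\infty]$ to state-action pairs, $E_s^{\sigma,\pi}(\rho)$ denotes the expectation of $\sum_{j\ge 0}\rho(s_j,a_j)$ over the infinite paths $s_0a_0s_1a_1\dots$ from $s_0=s$ under $\sigma,\pi$. Let $r$ be a reward structure with non-negative finite values such that $\sup_{\sigma,\pi}E_s^{\sigma,\pi}(r)<\infty$ for all $s\in S$, let $b\in\mathbb R$, and let $\psi(s,a)\in[0,\infty)$ ($s\in S_\Diamond$, $a$ an action) be a penalty function. A multi-strategy $\theta$ assigns to each $s\in S_\Diamond$ a distribution $\theta(s)$ on the non-empty subsets of $A(s)$. A controller strategy $\sigma$ complies with $\theta$ if for all $s\in S_\Diamond$ and non-empty $B\subseteq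 A(s)$ there are distributions $d_{s,B}$ on $B$ such that $\sigma(s)(a)=\sum_{B\ni a}\theta(s)(B)\,d_{s,B}(a)$ for all $a\in A(s)$. The multi-strategy $\theta$ is sound if $E_{\bar s}^{\sigma,\pi}(r)\ge b$ for every $\sigma$ complying with $\theta$ and every $\pi$. It has granularity $M\ge 1$ if every $\theta(s)(B)$ is an integer multiple of $\frac1M$. Its local penalty at $s\in S_\Diamond$ is $\mathrm{pen}_{loc}(\theta,s)=\sum_{B\subseteq A(s)}\sum_{a\in A(s)\setminus B}\theta(s)(B)\,\psi(s,a)$. Its static penalty is $\mathrm{pen}_{sta}(\theta)=\sum_{s\in S_\Diamond}\mathrm{pen}_{loc}(\theta,s)$. Its dynamic penalty is $\mathrm{pen}_{dyn}(\theta)=\sup E_{\bar s}^{\sigma,\pi}(\rho_\theta)\in[0,\infty]$, over all $\sigma$ complying with $\theta$ and all $\pi$, where $\rho_\theta(s,a)=\mathrm{pen}_{loc}(\theta,s)$ for $s\in S_\Diamond$ and $\rho_\theta(s,a)=0$ for $s\in S_\Box$. Theorem. Let $\theta$ be a sound multi-strategy and $\varepsilon>0$. For each penalty type $\tau\in\{sta,dyn\}$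 there are an integer $M\ge1$ and a sound multi-strategy $\theta'$ of granularity $M$ with $\mathrm{pen}_\tau(\theta')\le\mathrm{pen}_\tau(\theta)+\varepsilon$. Moreover, for static penalties it suffices to take $M=\max\{1,\lceil\sum_{s\in S_\Diamond}\sum_{a\in A(s)}\psi(s,a)/\varepsilon\rceil\}$; that is, for this $M$ there is a sound multi-strategy $\theta'$ of granularity $M$ with $\mathrm{pen}_{sta}(\theta')\le\mathrm{pen}_{sta}(\theta)+\varepsilon$. -/

import Mathlib

open scoped NNReal ENNReal

/-- A turn-based stochastic two-player game. `controller` is the set of states of the controller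
player; all other states belong to the environment. The partial transition function is given by
its domain (`enabled s` is the set of actions available in `s`) together with `trans`, whose values
at pairs `(s, a)` with `a ∉ enabled s` are never used. -/
structure StochasticGame (S Act : Type*) where
  controller : Finset S
  init : S
  enabled : S → Finset Act
  trans : S → Act → PMF S
  enabled_nonempty : ∀ s, (enabled s).Nonempty

/-- One step of a path: the current state and the action taken in it. -/
structure Move (S Act : Type*) where
  state : S
  action : Act

namespace Move

variable {S Act : Type*}

instance : MeasurableSpace (Move S Act) := ⊤

instance : MeasurableSingletonClass (Move S Act) := ⟨fun _ => trivial⟩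

instance [Countable S] [Countable Act] : Countable (Move S Act) :=
  Function.Injective.countable (f := fun m : Move S Act => (m.state, m.action)) (by
    rintro ⟨s, a⟩ ⟨t, b⟩ h
    simpa using h)

end Move

/-- Penalty types: static or dynamic. -/
inductive PenaltyType where
  | sta
  | dyn

namespace StochasticGame

variable {S Act : Type*}

/-- Memoryless (randomised) strategies of the controller. -/
structure ControllerStrategy (G : StochasticGame S Act) where
  toFun : {s // s ∈ G.controller} → PMF Act
  enabled : ∀ s a, toFun s a ≠ 0 → a ∈ G.enabled s

/-- Memoryless (randomised) strategies of the environment. -/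
structure EnvironmentStrategy (G : StochasticGame S Act) where
  toFun : {s // s ∉ G.controller} → PMF Act
  enabled : ∀ s a, toFun s a ≠ 0 → a ∈ G.enabled s

section Paths

variable [Fintype S] [DecidableEq S] [Fintype Act] (G : StochasticGame S Act)
  (σ : G.ControllerStrategy) (π : G.EnvironmentStrategy)

/-- The distribution of the action taken in `s` when the players use `σ` and `π`. -/
noncomputable def actionDist (s : S) : PMF Act :=
  if h : s ∈ G.controller then σ.toFun ⟨s, h⟩ else π.toFun ⟨s, h⟩

/-- The law of the first step of a path that starts in `s`. -/
noncomputable def firstMove (s : S) : PMF (Move S Act) :=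
  (G.actionDist σ π s).map (Move.mk s)

/-- The law of the next step of a path after the step `m`. -/
noncomputable def nextMove (m : Move S Act) : PMF (Move S Act) :=
  (G.trans m.state m.action).bind (G.firstMove σ π)

/-- `nextMove` as a kernel from histories of length `n + 1`. -/
noncomputable def moveKernel (n : ℕ) :
    ProbabilityTheory.Kernel ((i : Finset.Iic n) → Move S Act) (Move S Act) :=
  (ProbabilityTheory.Kernel.ofFunOfCountable fun m => (G.nextMove σ π m).toMeasure).comap
    (fun h => h ⟨n, Finset.mem_Iic.2 le_rfl⟩) (measurable_pi_apply _)

instance (n : ℕ) : ProbabilityTheory.IsMarkovKernel (G.moveKernel σ π n) :=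
  ⟨fun h => inferInstanceAs (MeasureTheory.IsProbabilityMeasure
    (G.nextMove σ π (h ⟨n, Finset.mem_Iic.2 le_rfl⟩)).toMeasure)⟩

/-- The probability measure on infinite paths `s₀ a₀ s₁ a₁ …` starting in `s` induced by `σ` and
`π` (by the Ionescu-Tulcea theorem). -/
noncomputable def pathMeasure (s : S) : MeasureTheory.Measure (ℕ → Move S Act) :=
  ProbabilityTheory.Kernel.trajMeasure (X := fun _ => Move S Act)
    (G.firstMove σ π s).toMeasure (G.moveKernel σ π)

/-- The expected total reward from `s` under `σ` and `π` for the reward structure `ρ`. -/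
noncomputable def expectedReward (s : S) (ρ : S → Act → ℝ≥0∞) : ℝ≥0∞ :=
  ∫⁻ ω, ∑' j : ℕ, ρ (ω j).state (ω j).action ∂(G.pathMeasure σ π s)

end Paths

/-- Memoryless (randomised) multi-strategies: in each controller state, a distribution over the
non-empty sets of enabled actions. -/
structure MultiStrategy (G : StochasticGame S Act) where
  toFun : {s // s ∈ G.controller} → PMF (Finset Act)
  empty : ∀ s, toFun s ∅ = 0
  enabled : ∀ s B, toFun s B ≠ 0 → B ⊆ G.enabled s

/-- `σ` complies with `θ`. Here `d s B` is the distribution over `B` that resolves the choice left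
open by `θ` when it allows the set `B` in `s`. -/
def Complies [DecidableEq Act] (G : StochasticGame S Act)
    (σ : G.ControllerStrategy) (θ : G.MultiStrategy) : Prop :=
  ∃ d : {s // s ∈ G.controller} → Finset Act → PMF Act,
    (∀ s : {s // s ∈ G.controller}, ∀ B ⊆ G.enabled s, B.Nonempty → ∀ a, d s B a ≠ 0 → a ∈ B) ∧
    ∀ s : {s // s ∈ G.controller}, ∀ a ∈ G.enabled s,
      σ.toFun s a = ∑ B ∈ (G.enabled s).powerset with a ∈ B, θ.toFun s B * d s B a

/-- `θ` has granularity `M`: all its probabilities are multiples of `1 / M`. -/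
def MultiStrategy.HasGranularity {G : StochasticGame S Act} (θ : G.MultiStrategy) (M : ℕ) : Prop :=
  0 < M ∧ ∀ s B, ∃ k : ℕ, θ.toFun s B = (k : ℝ≥0∞) / (M : ℝ≥0∞)

section Penalties

variable [Fintype S] [DecidableEq S] [Fintype Act] [DecidableEq Act] (G : StochasticGame S Act)

/-- The strategy `σ` is sound for the property "the expected total reward `r` from the initial
state is at least `b`", against all environment strategies. -/
def SoundStrategy (r : S → Act → ℝ≥0) (b : ℝ) (σ : G.ControllerStrategy) : Prop :=
  ∀ π : G.EnvironmentStrategy,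
    ENNReal.ofReal b ≤ G.expectedReward σ π G.init (fun s a => (r s a : ℝ≥0∞))

/-- A multi-strategy is sound if every strategy complying with it is sound. -/
def Sound (r : S → Act → ℝ≥0) (b : ℝ) (θ : G.MultiStrategy) : Prop :=
  ∀ σ : G.ControllerStrategy, G.Complies σ θ → G.SoundStrategy r b σ

/-- The local penalty of `θ` in the controller state `s`. -/
noncomputable def localPenalty (ψ : {s // s ∈ G.controller} → Act → ℝ≥0) (θ : G.MultiStrategy)
    (s : {s // s ∈ G.controller}) : ℝ≥0∞ :=
  ∑ B ∈ (G.enabled s).powerset, ∑ a ∈ G.enabled s \ B, θ.toFun s B * (ψ s a : ℝ≥0∞)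

/-- The static penalty: the sum of all local penalties. -/
noncomputable def staticPenalty (ψ : {s // s ∈ G.controller} → Act → ℝ≥0)
    (θ : G.MultiStrategy) : ℝ≥0∞ :=
  ∑ s : {s // s ∈ G.controller}, G.localPenalty ψ θ s

/-- The reward structure given by the local penalties in controller states, and `0` elsewhere. -/
noncomputable def penaltyReward (ψ : {s // s ∈ G.controller} → Act → ℝ≥0) (θ : G.MultiStrategy)
    (s : S) (_a : Act) : ℝ≥0∞ :=
  if h : s ∈ G.controller then G.localPenalty ψ θ ⟨s, h⟩ else 0

/-- The dynamic penalty: the worst-case expected sum of local penalties from the initial state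
(possibly `∞`). -/
noncomputable def dynamicPenalty (ψ : {s // s ∈ G.controller} → Act → ℝ≥0)
    (θ : G.MultiStrategy) : ℝ≥0∞ :=
  ⨆ (σ : G.ControllerStrategy) (_ : G.Complies σ θ) (π : G.EnvironmentStrategy),
    G.expectedReward σ π G.init (G.penaltyReward ψ θ)

/-- The penalty of `θ` under the penalty scheme `(ψ, τ)`. -/
noncomputable def penalty (ψ : {s // s ∈ G.controller} → Act → ℝ≥0) (τ : PenaltyType)
    (θ : G.MultiStrategy) : ℝ≥0∞ :=
  match τ with
  | .sta => G.staticPenalty ψ θ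
  | .dyn => G.dynamicPenalty ψ θ

end Penalties

end StochasticGame

/-! Soundness is turned into local conditions that rounding can preserve. Let `v` be the least fixed
point of the worst-case one-step operator `minStep`. An inequality `v ≤ minStep v` alone does not
bound expected rewards from below, since a cycle without reward may carry any constant value.
`Certificate` therefore adds a rank: wherever `v` is non-zero, play must with positive probability
earn a reward, change the value of `v`, or decrease the rank. Leastness of `v` supplies the rank
(`exists_certificate`). Conversely, a certificate bounds the reward of every compliant strategy from
below (`Certificate.le_expectedReward`), by a maximum principle on the induced Markov chain
(`le_of_progress`). Hence `θ` may be changed at each state freely, as long as the expectation of the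
least action value in the allowed set does not drop and some allowed set consisting of progressing
actions keeps positive probability (`Certificate.of_le`).

Static penalties: at each state the actions are ordered by value, with progress as tie-breaker, and
the random set is replaced by a uniformly chosen member of a list of `M` nested upper sets of this
order (`PMF.exists_round_subset`). Rounding up the probability that all allowed actions lie strictly
above `a` makes the worst value stochastically larger, and each action is missed with probability at
most `1 / M` more than before. The total increase is at most the sum of all `ψ s a`, divided by `M`.

Dynamic penalties: a nested rounding may change supports, so probabilities are instead rounded
within a factor `1 + η`, moving mass only to a set with the best value
(`PMF.eventually_exists_round`). In a chain with `n` states this multiplies total rewards by at most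
`(1 + η) ^ (2 * n)` (`chainReward_le_of_ratio`), with no finiteness assumption, and `η` is chosen
small after the penalty is known. -/

open MeasureTheory ProbabilityTheory

/-! ### Total rewards of finite Markov chains and their sensitivity to the transition matrix. -/

section Chain

variable {S : Type*} [Fintype S]

/-- The expected total reward, as a function of the initial state, of a Markov chain with
transition matrix `P` that collects the reward `c s` at each visit of `s`. -/
noncomputable def chainReward (P : S → S → ℝ≥0∞) (c : S → ℝ≥0∞) (s : S) : ℝ≥0∞ :=
  ∑' j : ℕ, (fun (f : S → ℝ≥0∞) s => ∑ t, P s t * f t)^[j] c s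

lemma chainReward_eq (P : S → S → ℝ≥0∞) (c : S → ℝ≥0∞) (s : S) :
    chainReward P c s = c s + ∑ t, P s t * chainReward P c t := by
  unfold chainReward
  rw [tsum_eq_zero_add' ENNReal.summable]
  simp only [Function.iterate_zero, id, Function.iterate_succ_apply']
  rw [Summable.tsum_finsetSum fun _ _ => ENNReal.summable]
  simp only [ENNReal.tsum_mul_left]

lemma chainReward_le {P : S → S → ℝ≥0∞} {c y : S → ℝ≥0∞}
    (hy : ∀ s, c s + ∑ t, P s t * y t ≤ y s) (s : S) : chainReward P c s ≤ y s := by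
  refine ENNReal.summable.tsum_le_of_sum_range_le fun n => ?_
  induction n generalizing s with
  | zero => simp
  | succ n ih =>
    rw [Finset.sum_range_succ']
    simp only [Function.iterate_zero, id, Function.iterate_succ_apply']
    rw [Finset.sum_comm, add_comm]
    refine le_trans ?_ (hy s)
    gcongr with t
    rw [← Finset.mul_sum]
    gcongr
    exact ih t

variable [DecidableEq S]

/-- Changing one row of a Markov chain by at most a factor `L` changes the expected total rewards
by at most a factor `L ^ 2`. -/
lemma chainReward_le_of_row {P P' : S → S → ℝ≥0∞} {c c' : S → ℝ≥0∞} {L : ℝ≥0∞} (hL : 1 ≤ L)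
    (s₀ : S) (hP : ∀ s, ∑ t, P s t = 1) (hP' : ∑ t, P' s₀ t = 1)
    (hPne : ∀ s ≠ s₀, ∀ t, P' s t = P s t) (hcne : ∀ s ≠ s₀, c' s = c s)
    (hle : ∀ t, P' s₀ t ≤ L * P s₀ t) (hge : ∀ t, P s₀ t ≤ L * P' s₀ t)
    (hc : c' s₀ ≤ L * c s₀) (s : S) :
    chainReward P' c' s ≤ L ^ 2 * chainReward P c s := by
  set x := chainReward P c with hx
  have hxeq : ∀ s, x s = c s + ∑ t, P s t * x t := chainReward_eq P c
  -- `h s` is the probability of reaching `s₀` from `s`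
  set Q : S → S → ℝ≥0∞ := fun s t => if s = s₀ then 0 else P s t with hQ
  set e : S → ℝ≥0∞ := fun s => if s = s₀ then 1 else 0 with he
  set h := chainReward Q e with hh
  have hh0 : h s₀ = 1 := by
    rw [hh, chainReward_eq]; simp [hQ, he]
  have hhne : ∀ s ≠ s₀, h s = ∑ t, P s t * h t := by
    intro s hs
    rw [hh, chainReward_eq]; simp [hQ, he, hs]
  have hh1 : ∀ s, h s ≤ 1 := by
    refine chainReward_le (y := fun _ => 1) fun s => ?_
    by_cases hs : s = s₀ <;> simp [hQ, he, hs, hP]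
  have hK : (1 : ℝ≥0∞) ≤ L ^ 2 := one_le_pow₀ hL
  -- The candidate super-solution for the new chain: the reward from `s₀` on is inflated by `L ^ 2`,
  -- weighted by the chance of ever reaching `s₀`. Away from `s₀` it satisfies the old equation
  -- exactly, because `h` is harmonic there.
  set y : S → ℝ≥0∞ := fun s => x s + h s * ((L ^ 2 - 1) * x s₀) with hy
  have hadd : ∀ z : ℝ≥0∞, z + (L ^ 2 - 1) * z = L ^ 2 * z := by
    intro z
    nth_rw 1 [← one_mul z]
    rw [← add_mul, add_tsub_cancel_of_le hK]
  have hhx : x s₀ ≠ ∞ → ∀ s, h s * x s₀ ≤ x s := by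
    intro htop s
    rcases eq_or_ne (x s₀) 0 with h0 | h0
    · simp [h0]
    rw [← ENNReal.le_div_iff_mul_le (Or.inl h0) (Or.inl htop)]
    refine chainReward_le (y := fun s => x s / x s₀) (fun s => ?_) s
    by_cases hs : s = s₀
    · simp [hQ, he, hs, ENNReal.div_self h0 htop]
    · simp only [he, hs, if_false, hQ, zero_add, div_eq_mul_inv, ← mul_assoc, ← Finset.sum_mul]
      gcongr
      rw [hxeq s]
      exact le_add_self
  have hsup : ∀ s, c' s + ∑ t, P' s t * y t ≤ y s := by
    intro s
    by_cases hs : s = s₀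
    · subst hs
      rcases eq_or_ne (x s) ∞ with htop | htop
      · simp [hy, htop]
      have hys : y s = L ^ 2 * x s := by simp only [hy, hh0, one_mul, hadd]
      rw [hys]
      -- `w t` is the reward collected from `t` before `s₀` is reached, and `g t` the probability of
      -- never reaching it. The subtraction is genuine by `hhx`.
      set w : S → ℝ≥0∞ := fun t => x t - h t * x s with hw
      set g : S → ℝ≥0∞ := fun t => 1 - h t with hg
      have hgh : ∀ t, g t + h t = 1 := fun t => tsub_add_cancel_of_le (hh1 t)
      have hxw : ∀ t, x t = w t + h t * x s := fun t =>
        (tsub_add_cancel_of_le (hhx htop t)).symm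
      have hyw : ∀ t, y t = w t + h t * (L ^ 2 * x s) := fun t => by
        simp only [hy]
        rw [hxw t, add_assoc, ← mul_add, hadd]
      -- Reward of one excursion from `s₀` equals escape probability times total reward. The change
      -- of row raises the former by at most `L` and lowers the latter factor by at most `L`, which
      -- is where `L ^ 2` comes from.
      have hbal : c s + ∑ t, P s t * w t = (∑ t, P s t * g t) * x s := by
        have hfin : (∑ t, P s t * h t) * x s ≠ ∞ := by
          refine ENNReal.mul_ne_top (ne_top_of_le_ne_top ENNReal.one_ne_top ?_) htop
          rw [← hP s]
          gcongr with t
          exact mul_le_of_le_one_right' (hh1 t)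
        refine (ENNReal.add_left_inj hfin).1 ?_
        rw [← add_mul, ← Finset.sum_add_distrib]
        simp only [← mul_add, hgh, mul_one, hP, one_mul]
        conv_rhs => rw [hxeq s]
        rw [add_assoc, Finset.sum_mul, ← Finset.sum_add_distrib]
        congr 1
        refine Finset.sum_congr rfl fun t _ => ?_
        conv_rhs => rw [hxw t]
        ring
      calc c' s + ∑ t, P' s t * y t
          = (c' s + ∑ t, P' s t * w t) + (∑ t, P' s t * h t) * (L ^ 2 * x s) := by
            rw [add_assoc, Finset.sum_mul, ← Finset.sum_add_distrib]
            congr 1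
            refine Finset.sum_congr rfl fun t _ => ?_
            rw [hyw t]; ring
        _ ≤ L * (c s + ∑ t, P s t * w t) + (∑ t, P' s t * h t) * (L ^ 2 * x s) := by
            rw [mul_add, Finset.mul_sum]
            simp only [← mul_assoc L]
            gcongr with t
            exact hle t
        _ = L * ((∑ t, P s t * g t) * x s) + (∑ t, P' s t * h t) * (L ^ 2 * x s) := by rw [hbal]
        _ ≤ L * ((∑ t, L * P' s t * g t) * x s) + (∑ t, P' s t * h t) * (L ^ 2 * x s) := by
            gcongr with t
            exact hge t
        _ = (∑ t, P' s t * (g t + h t)) * (L ^ 2 * x s) := by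
            simp only [mul_add, Finset.sum_add_distrib, mul_assoc, ← Finset.mul_sum]
            ring
        _ = L ^ 2 * x s := by simp only [hgh, mul_one, hP', one_mul]
    · refine le_of_eq ?_
      rw [hcne s hs]
      simp only [hPne s hs, hy, mul_add, Finset.sum_add_distrib]
      rw [← add_assoc, ← hxeq s, hhne s hs, Finset.sum_mul]
      simp only [mul_assoc]
  refine (chainReward_le hsup s).trans ?_
  rcases eq_or_ne (x s₀) ∞ with htop | htop
  · rcases eq_or_ne (h s) 0 with h0 | h0
    · simp only [hy, h0, zero_mul, add_zero]
      exact le_mul_of_one_le_left' hK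
    · have hxs : x s = ∞ := by
        -- the states with infinite reward contain all states from which `s₀` is reachable
        by_contra hne
        apply h0
        have := chainReward_le (P := Q) (c := e) (y := fun s => if x s = ∞ then 1 else 0)
          (fun s => ?_) s
        · simpa [hne] using this
        by_cases hs : s = s₀
        · simp [hQ, he, hs, htop]
        · simp only [hQ, he, hs, if_false, zero_add]
          split_ifs with hi
          · refine (Finset.sum_le_sum fun t _ => ?_).trans_eq (hP s)
            split_ifs <;> simp
          · refine le_of_eq (Finset.sum_eq_zero fun t _ => ?_)
            split_ifs with ht
            · have hle : P s t * x t ≤ x s := by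
                conv_rhs => rw [hxeq s]
                exact le_add_of_le_right
                  (Finset.single_le_sum (f := fun t => P s t * x t) (fun _ _ => zero_le)
                    (Finset.mem_univ t))
              rw [ht] at hle
              by_contra hp
              rw [mul_one] at hp
              rw [ENNReal.mul_top hp] at hle
              exact hi (top_le_iff.1 hle)
            · simp
      rw [hxs, ENNReal.mul_top (by positivity)]
      exact le_top
  · rw [← hadd (x s)]
    simp only [hy]
    rw [mul_left_comm]
    gcongr
    exact hhx htop s

/-- Changing the rows of a Markov chain by at most a factor `L` changes the expected total rewards
by at most a factor `L ^ (2 * n)`, where `n` is the number of states. -/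
lemma chainReward_le_of_ratio {P P' : S → S → ℝ≥0∞} {c c' : S → ℝ≥0∞} {L : ℝ≥0∞} (hL : 1 ≤ L)
    (hP : ∀ s, ∑ t, P s t = 1) (hP' : ∀ s, ∑ t, P' s t = 1)
    (hle : ∀ s t, P' s t ≤ L * P s t) (hge : ∀ s t, P s t ≤ L * P' s t)
    (hc : ∀ s, c' s ≤ L * c s) (s : S) :
    chainReward P' c' s ≤ (L ^ 2) ^ Fintype.card S * chainReward P c s := by
  -- Rows are replaced one at a time, each replacement costing a factor `L ^ 2`. The row being
  -- replaced is still the original one, so the ratio hypotheses apply to it.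
  have key : ∀ T : Finset S, ∀ s,
      chainReward (fun s t => if s ∈ T then P' s t else P s t)
        (fun s => if s ∈ T then c' s else c s) s ≤ (L ^ 2) ^ T.card * chainReward P c s := by
    intro T
    induction T using Finset.induction_on with
    | empty => simp
    | insert a T ha ih =>
      intro s
      rw [Finset.card_insert_of_notMem ha, pow_succ', mul_assoc]
      refine le_trans ?_ (mul_le_mul_right (ih s) _)
      refine chainReward_le_of_row hL a ?_ ?_ ?_ ?_ ?_ ?_ ?_ s
      · intro s; split_ifs <;> simp [hP, hP']
      · simp [hP']
      · intro s hs t; simp [hs]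
      · intro s hs; simp [hs]
      · intro t; simpa [ha] using hle a t
      · intro t; simpa [ha] using hge a t
      · simpa [ha] using hc a
  simpa using key Finset.univ s

end Chain

/-- A function `v` with `v ≤ c + P v` is at most the total reward `x` if from every state with
positive `v` the chain collects a reward, changes the value of `v` or decreases `rank` with positive
probability. -/
lemma le_of_progress {S : Type*} [Fintype S] {P : S → S → ℝ} {c x v : S → ℝ} {rank : S → ℕ}
    (hP0 : ∀ s t, 0 ≤ P s t) (hP1 : ∀ s, ∑ t, P s t = 1) (hc : ∀ s, 0 ≤ c s)
    (hx0 : ∀ s, 0 ≤ x s) (hx : ∀ s, x s = c s + ∑ t, P s t * x t)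
    (hv : ∀ s, v s ≤ c s + ∑ t, P s t * v t)
    (hprog : ∀ s, 0 < v s → 0 < c s ∨ ∃ t, 0 < P s t ∧ (v t ≠ v s ∨ rank t < rank s)) (s : S) :
    v s ≤ x s := by
  classical
  by_contra hlt
  push Not at hlt
  obtain ⟨s₁, -, hs₁⟩ := Finset.exists_max_image Finset.univ (fun s => v s - x s)
    ⟨s, Finset.mem_univ s⟩
  set m := v s₁ - x s₁ with hm
  have hmax : ∀ t, v t - x t ≤ m := fun t => hs₁ t (Finset.mem_univ t)
  have hmpos : 0 < m := by linarith [hmax s]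
  -- Maximum principle: `v - x` is subharmonic, so from a maximiser the chain moves only to
  -- maximisers.
  have hclosed : ∀ s, v s - x s = m → ∀ t, 0 < P s t → v t - x t = m := by
    intro s hs t ht
    have hsum : ∑ t, P s t * (m - (v t - x t)) ≤ 0 := by
      simp only [mul_sub, Finset.sum_sub_distrib, ← Finset.sum_mul, hP1]
      linarith [hv s, hx s]
    have h0 := (Finset.sum_eq_zero_iff_of_nonneg (fun t _ =>
      mul_nonneg (hP0 s t) (sub_nonneg.2 (hmax t)))).1
      (le_antisymm hsum (Finset.sum_nonneg fun t _ =>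
      mul_nonneg (hP0 s t) (sub_nonneg.2 (hmax t)))) t (Finset.mem_univ t)
    rcases mul_eq_zero.1 h0 with h | h <;> linarith
  -- Among the maximisers of `v - x` take those with least `x`, and among these one of least rank.
  -- Since `x` is there its own one-step average plus reward, no reward is earned and all successors
  -- have the same `x`, hence the same `v`; only a decrease of the rank is left, and minimality
  -- excludes it.
  obtain ⟨s₂, hs₂C, hs₂⟩ := Finset.exists_min_image (Finset.univ.filter fun s => v s - x s = m) x
    ⟨s₁, by simp [hm]⟩
  simp only [Finset.mem_filter, Finset.mem_univ, true_and] at hs₂C hs₂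
  obtain ⟨s₃, hs₃D, hs₃⟩ := Finset.exists_min_image
    (Finset.univ.filter fun s => v s - x s = m ∧ x s = x s₂) rank ⟨s₂, by simp [hs₂C]⟩
  simp only [Finset.mem_filter, Finset.mem_univ, true_and] at hs₃D hs₃
  obtain ⟨hsm, hsx⟩ := hs₃D
  have hnn : ∀ t, 0 ≤ P s₃ t * (x t - x s₂) := by
    intro t
    rcases (hP0 s₃ t).eq_or_lt with h | h
    · simp [← h]
    · exact mul_nonneg h.le (sub_nonneg.2 (hs₂ t (hclosed s₃ hsm t h)))
  have hsum : c s₃ + ∑ t, P s₃ t * (x t - x s₂) = 0 := by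
    simp only [mul_sub, Finset.sum_sub_distrib, ← Finset.sum_mul, hP1]
    linarith [hx s₃]
  have hsum0 := Finset.sum_nonneg fun t (_ : t ∈ Finset.univ) => hnn t
  have hvpos : 0 < v s₃ := by linarith [hx0 s₃]
  rcases hprog s₃ hvpos with h | ⟨t, ht, h⟩
  · linarith
  · have h0 := (Finset.sum_eq_zero_iff_of_nonneg (fun t _ => hnn t)).1
      (by linarith [hc s₃]) t (Finset.mem_univ t)
    have hxt : x t = x s₂ := by
      rcases mul_eq_zero.1 h0 with h | h <;> linarith
    have hvt := hclosed s₃ hsm t ht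
    rcases h with h | h
    · exact h (by linarith)
    · exact absurd (hs₃ t ⟨hvt, hxt⟩) (not_le.2 h)

/-! ### From path measures to the induced Markov chain. -/

lemma PMF.lintegral_eq_sum {α : Type*} [Fintype α] [MeasurableSpace α] [MeasurableSingletonClass α]
    (p : PMF α) (f : α → ℝ≥0∞) : ∫⁻ a, f a ∂p.toMeasure = ∑ a, p a * f a := by
  rw [lintegral_fintype]
  refine Finset.sum_congr rfl fun a _ => ?_
  rw [p.toMeasure_apply_singleton a (measurableSet_singleton a), mul_comm]

lemma PMF.sum_coe {α : Type*} [Fintype α] (p : PMF α) : ∑ a, p a = 1 := by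
  rw [← tsum_fintype (L := .unconditional α), p.tsum_coe]

lemma PMF.sum_bind {α β : Type*} [Fintype α] [Fintype β] (p : PMF α) (q : α → PMF β)
    (f : β → ℝ≥0∞) : ∑ b, p.bind q b * f b = ∑ a, p a * ∑ b, q a b * f b := by
  simp only [PMF.bind_apply, tsum_fintype, Finset.sum_mul, Finset.mul_sum, mul_assoc]
  exact Finset.sum_comm

lemma PMF.sum_pure {α : Type*} [Fintype α] (a : α) (f : α → ℝ≥0∞) :
    ∑ b, PMF.pure a b * f b = f a := by
  classical
  simp [PMF.pure_apply]

lemma PMF.sum_map {α β : Type*} [Fintype α] [Fintype β] (p : PMF α) (g : α → β)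
    (f : β → ℝ≥0∞) : ∑ b, p.map g b * f b = ∑ a, p a * f (g a) := by
  simp only [PMF.map, PMF.sum_bind, Function.comp, PMF.sum_pure]

namespace StochasticGame

variable {S Act : Type*} [Fintype S] [DecidableEq S] [Fintype Act] (G : StochasticGame S Act)
  (σ : G.ControllerStrategy) (π : G.EnvironmentStrategy)

instance : Fintype (Move S Act) :=
  Fintype.ofEquiv (S × Act) ⟨fun p => ⟨p.1, p.2⟩, fun m => (m.state, m.action),
    fun _ => rfl, fun _ => rfl⟩

lemma lintegral_pathMeasure_zero (s : S) (f : Move S Act → ℝ≥0∞) :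
    ∫⁻ ω, f (ω 0) ∂(G.pathMeasure σ π s) = ∫⁻ m, f m ∂(G.firstMove σ π s).toMeasure := by
  have hf : Measurable f := Measurable.of_discrete
  have : (G.pathMeasure σ π s).map (fun ω => ω 0) = (G.firstMove σ π s).toMeasure := by
    have h0 : (G.pathMeasure σ π s).map (Preorder.frestrictLe 0) =
        (G.firstMove σ π s).toMeasure.map (MeasurableEquiv.piUnique _).symm := by
      rw [pathMeasure, Kernel.trajMeasure, Measure.map_comp _ _ (by fun_prop),
        Kernel.traj_map_frestrictLe, Kernel.partialTraj_self, Measure.id_comp]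
    have h1 := congrArg (fun μ => μ.map fun x => x ⟨0, Finset.mem_Iic.2 le_rfl⟩) h0
    rw [Measure.map_map (by fun_prop) (by fun_prop), Measure.map_map (by fun_prop) (by fun_prop)]
      at h1
    refine h1.trans ?_
    conv_rhs => rw [← Measure.map_id (μ := (G.firstMove σ π s).toMeasure)]
    rfl
  rw [← this, lintegral_map hf (by fun_prop)]

lemma lintegral_pathMeasure_succ (s : S) (n : ℕ) (f : Move S Act → ℝ≥0∞) :
    ∫⁻ ω, f (ω (n + 1)) ∂(G.pathMeasure σ π s) =
      ∫⁻ ω, (∫⁻ m, f m ∂(G.nextMove σ π (ω n)).toMeasure) ∂(G.pathMeasure σ π s) := by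
  have hf : Measurable f := Measurable.of_discrete
  have h := Kernel.map_frestrictLe_trajMeasure_compProd_eq_map_trajMeasure
    (X := fun _ => Move S Act) (μ₀ := (G.firstMove σ π s).toMeasure) (κ := G.moveKernel σ π) (a := n)
  have h2 := congrArg (fun μ => ∫⁻ p, f p.2 ∂μ) h
  rw [Measure.lintegral_compProd (by fun_prop), lintegral_map ?_ (by fun_prop),
    lintegral_map ?_ (by fun_prop)] at h2
  · exact h2.symm
  · fun_prop
  · exact Measurable.lintegral_kernel (f := f) hf

/-- The transition matrix of the Markov chain on the states induced by `σ` and `π`. -/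
noncomputable def chainMatrix (s t : S) : ℝ≥0∞ :=
  ∑ a, G.actionDist σ π s a * G.trans s a t

/-- The expected immediate reward in a state under `σ` and `π`. -/
noncomputable def stepReward (ρ : S → Act → ℝ≥0∞) (s : S) : ℝ≥0∞ :=
  ∑ a, G.actionDist σ π s a * ρ s a

lemma sum_chainMatrix_mul (f : S → ℝ≥0∞) (s : S) :
    ∑ t, G.chainMatrix σ π s t * f t =
      ∑ a, G.actionDist σ π s a * ∑ t, G.trans s a t * f t := by
  simp only [chainMatrix, Finset.sum_mul, Finset.mul_sum, mul_assoc]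
  exact Finset.sum_comm

lemma sum_chainMatrix (s : S) : ∑ t, G.chainMatrix σ π s t = 1 := by
  simpa [PMF.sum_coe] using G.sum_chainMatrix_mul σ π (fun _ => 1) s

lemma lintegral_firstMove (s : S) (f : Move S Act → ℝ≥0∞) :
    ∫⁻ m, f m ∂(G.firstMove σ π s).toMeasure = ∑ a, G.actionDist σ π s a * f ⟨s, a⟩ := by
  rw [PMF.lintegral_eq_sum, firstMove, PMF.sum_map]

lemma lintegral_nextMove (m : Move S Act) (f : Move S Act → ℝ≥0∞) :
    ∫⁻ m', f m' ∂(G.nextMove σ π m).toMeasure =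
      ∑ t, G.trans m.state m.action t * ∫⁻ m', f m' ∂(G.firstMove σ π t).toMeasure := by
  simp only [PMF.lintegral_eq_sum, nextMove, PMF.sum_bind]

lemma lintegral_pathMeasure (s : S) (f : Move S Act → ℝ≥0∞) (n : ℕ) :
    ∫⁻ ω, f (ω n) ∂(G.pathMeasure σ π s) =
      (fun (g : S → ℝ≥0∞) s => ∑ t, G.chainMatrix σ π s t * g t)^[n]
        (fun s => ∑ a, G.actionDist σ π s a * f ⟨s, a⟩) s := by
  induction n generalizing f with
  | zero => rw [lintegral_pathMeasure_zero, lintegral_firstMove]; rfl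
  | succ n ih =>
    rw [lintegral_pathMeasure_succ, ih fun m => ∫⁻ m', f m' ∂(G.nextMove σ π m).toMeasure,
      Function.iterate_succ_apply]
    refine congrFun (congrArg _ ?_) s
    funext s
    simp only [sum_chainMatrix_mul, lintegral_nextMove, lintegral_firstMove]

/-- Linearity of expectation and the one-step marginals reduce everything to finite sums; path
measures play no role beyond this point. -/
lemma expectedReward_eq_chainReward (s : S) (ρ : S → Act → ℝ≥0∞) :
    G.expectedReward σ π s ρ = chainReward (G.chainMatrix σ π) (G.stepReward σ π ρ) s := by
  rw [expectedReward, lintegral_tsum]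
  · simp only [G.lintegral_pathMeasure σ π s fun m => ρ m.state m.action]
    rfl
  · intro j
    have : Measurable fun m : Move S Act => ρ m.state m.action := Measurable.of_discrete
    exact (this.comp (measurable_pi_apply j)).aemeasurable

/-- The expected immediate reward of taking the action `a` in `s`, followed by the reward `f`. -/
noncomputable def actionValue (ρ : S → Act → ℝ≥0∞) (f : S → ℝ≥0∞) (s : S) (a : Act) : ℝ≥0∞ :=
  ρ s a + ∑ t, G.trans s a t * f t

lemma stepReward_add (ρ : S → Act → ℝ≥0∞) (f : S → ℝ≥0∞) (s : S) :
    G.stepReward σ π ρ s + ∑ t, G.chainMatrix σ π s t * f t =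
      ∑ a, G.actionDist σ π s a * G.actionValue ρ f s a := by
  simp only [stepReward, sum_chainMatrix_mul, actionValue, mul_add, Finset.sum_add_distrib]

lemma expectedReward_eq (s : S) (ρ : S → Act → ℝ≥0∞) :
    G.expectedReward σ π s ρ = ∑ a, G.actionDist σ π s a *
      G.actionValue ρ (fun t => G.expectedReward σ π t ρ) s a := by
  rw [← stepReward_add]
  simp only [expectedReward_eq_chainReward]
  exact chainReward_eq _ _ _

lemma expectedReward_le {ρ : S → Act → ℝ≥0∞} {f : S → ℝ≥0∞}
    (hf : ∀ s, ∑ a, G.actionDist σ π s a * G.actionValue ρ f s a ≤ f s) (s : S) :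
    G.expectedReward σ π s ρ ≤ f s := by
  rw [expectedReward_eq_chainReward]
  exact chainReward_le (fun s => by rw [stepReward_add]; exact hf s) s

end StochasticGame

/-! ### Ranks from predicate transformers. -/

/-- If iterating a predicate transformer reaches all points, its rounds define a rank. -/
lemma exists_rank_of_forall_subset {S : Type*} [Fintype S] (Φ : Set S → Set S)
    (hΦ : Monotone Φ) (h : ∀ Z, Φ Z ⊆ Z → Z = Set.univ) :
    ∃ rank : S → ℕ, ∀ s, s ∈ Φ {t | rank t < rank s} := by
  classical
  have key : ∀ n, n ≤ Fintype.card S → ∃ Z : Finset S, n ≤ Z.card ∧ ∃ rank : S → ℕ,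
      ∀ s ∈ Z, s ∈ Φ {t | t ∈ Z ∧ rank t < rank s} := by
    intro n
    induction n with
    | zero => exact fun _ => ⟨∅, by simp, fun _ => 0, by simp⟩
    | succ n ih =>
      intro hn
      obtain ⟨Z, hZ, rank, hrank⟩ := ih (by omega)
      by_cases huniv : (Z : Set S) = Set.univ
      · refine ⟨Z, ?_, rank, hrank⟩
        rw [Finset.coe_eq_univ.1 huniv]
        simpa using hn
      obtain ⟨s, hs, hsZ⟩ := Set.not_subset.1 (mt (h Z) huniv)
      rw [Finset.mem_coe] at hsZ
      -- The new state is ranked above all of `Z`, so the ranks on `Z` and their justifications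
      -- survive.
      refine ⟨insert s Z, by rw [Finset.card_insert_of_notMem hsZ]; omega,
        fun t => if t = s then Z.sup rank + 1 else rank t, fun t ht => ?_⟩
      have hne : ∀ u ∈ Z, u ≠ s := fun u hu hus => hsZ (hus ▸ hu)
      rcases Finset.mem_insert.1 ht with rfl | ht
      · refine hΦ ?_ hs
        intro u hu
        have hu' : u ∈ Z := hu
        simpa [hu', hne u hu'] using Nat.lt_succ_of_le (Finset.le_sup (f := rank) hu')
      · refine hΦ ?_ (hrank t ht)
        rintro u ⟨hu, hlt⟩
        simpa [hu, hne u hu, hne t ht] using hlt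
  obtain ⟨Z, hZ, rank, hrank⟩ := key _ le_rfl
  have hZu : Z = Finset.univ := (Finset.card_eq_iff_eq_univ Z).1
    (le_antisymm (Finset.card_le_univ Z) hZ)
  subst hZu
  exact ⟨rank, fun s => by simpa using hrank s (Finset.mem_univ s)⟩

lemma PMF.le_sum_mul {α : Type*} [Fintype α] (p : PMF α) {f : α → ℝ≥0∞} {m : ℝ≥0∞}
    (h : ∀ a, p a ≠ 0 → m ≤ f a) : m ≤ ∑ a, p a * f a := by
  rw [← one_mul m, ← PMF.sum_coe p, Finset.sum_mul]
  refine Finset.sum_le_sum fun a _ => ?_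
  by_cases ha : p a = 0
  · simp [ha]
  · gcongr
    exact h a ha

namespace StochasticGame

/-! ### Compliant strategies as resolutions of a multi-strategy. -/

section Resolve

variable {S Act : Type*} {G : StochasticGame S Act}

/-- `d` chooses, in each controller state, an action from each set that may be allowed there. -/
def IsResolution (G : StochasticGame S Act)
    (d : {s // s ∈ G.controller} → Finset Act → PMF Act) : Prop :=
  ∀ s : {s // s ∈ G.controller}, ∀ B ⊆ G.enabled s, B.Nonempty → ∀ a, d s B a ≠ 0 → a ∈ B

/-- A resolution is unconstrained on empty or non-enabled sets, but `θ` gives these sets probability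
zero, so sums over all finite sets agree with the filtered ones. -/
lemma IsResolution.mul_eq_zero {d : {s // s ∈ G.controller} → Finset Act → PMF Act}
    (hd : G.IsResolution d) (θ : G.MultiStrategy) (s : {s // s ∈ G.controller}) {B : Finset Act}
    {a : Act} (h : a ∈ G.enabled s → B ⊆ G.enabled s → a ∉ B) : θ.toFun s B * d s B a = 0 := by
  by_contra hne
  obtain ⟨h1, h2⟩ := mul_ne_zero_iff.1 hne
  have hB := θ.enabled s B h1
  have hne : B.Nonempty := Finset.nonempty_iff_ne_empty.2 fun h => h1 (h ▸ θ.empty s)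
  have ha := hd s B hB hne a h2
  exact h (hB ha) hB ha

/-- The controller strategy that draws a set from `θ` and an action from this set by `d`. -/
noncomputable def MultiStrategy.resolve (θ : G.MultiStrategy)
    (d : {s // s ∈ G.controller} → Finset Act → PMF Act) (hd : G.IsResolution d) :
    G.ControllerStrategy where
  toFun s := (θ.toFun s).bind (d s)
  enabled s a h := by
    by_contra ha
    apply h
    rw [PMF.bind_apply, ENNReal.tsum_eq_zero]
    exact fun B => hd.mul_eq_zero θ s fun h => absurd h ha

variable [Fintype Act] [DecidableEq Act]

lemma bind_eq_sum_filter (θ : G.MultiStrategy)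
    {d : {s // s ∈ G.controller} → Finset Act → PMF Act} (hd : G.IsResolution d)
    (s : {s // s ∈ G.controller}) (a : Act) :
    (θ.toFun s).bind (d s) a =
      ∑ B ∈ (G.enabled s).powerset with a ∈ B, θ.toFun s B * d s B a := by
  rw [PMF.bind_apply, tsum_fintype, eq_comm]
  refine Finset.sum_subset (Finset.subset_univ _) fun B _ hB => ?_
  refine hd.mul_eq_zero θ s fun _ hBs haB => hB ?_
  simp [hBs, haB]

lemma complies_resolve (θ : G.MultiStrategy)
    {d : {s // s ∈ G.controller} → Finset Act → PMF Act} (hd : G.IsResolution d) :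
    G.Complies (θ.resolve d hd) θ :=
  ⟨d, hd, fun s a _ => bind_eq_sum_filter θ hd s a⟩

/-- Separates the resolution `d` from `θ`, so that the same `d` can later be applied to a rounded
multi-strategy. -/
lemma Complies.exists_eq_resolve {σ : G.ControllerStrategy} {θ : G.MultiStrategy}
    (h : G.Complies σ θ) : ∃ d, ∃ hd : G.IsResolution d, σ = θ.resolve d hd := by
  obtain ⟨d, hd, hσ⟩ := h
  refine ⟨d, hd, ?_⟩
  have hfun : σ.toFun = (θ.resolve d hd).toFun := by
    funext s
    ext a
    change _ = (θ.toFun s).bind (d s) a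
    by_cases ha : a ∈ G.enabled s
    · rw [hσ s a ha, bind_eq_sum_filter θ hd]
    · rw [not_not.1 (mt (σ.enabled s a) ha), PMF.bind_apply, eq_comm, ENNReal.tsum_eq_zero]
      exact fun B => IsResolution.mul_eq_zero hd θ s fun h => absurd h ha
  cases σ
  simp only at hfun
  subst hfun
  rfl

end Resolve

/-! ### Worst-case values and certificates for lower bounds. -/

lemma actionValue_mono {S Act : Type*} [Fintype S] (G : StochasticGame S Act)
    (ρ : S → Act → ℝ≥0∞) {f g : S → ℝ≥0∞} (h : f ≤ g) (s : S) (a : Act) :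
    G.actionValue ρ f s a ≤ G.actionValue ρ g s a := by
  unfold actionValue
  gcongr with t
  exact h t

/-- Taking `a` in `s` has a positive chance to collect a reward, to change the value of `v` or to
reach a state in `Z`. -/
def Progresses {S Act : Type*} (G : StochasticGame S Act) (ρ : S → Act → ℝ≥0∞)
    (v : S → ℝ≥0∞) (Z : Set S) (s : S) (a : Act) : Prop :=
  ρ s a ≠ 0 ∨ ∃ t, G.trans s a t ≠ 0 ∧ (v t ≠ v s ∨ t ∈ Z)

lemma actionValue_eq_zero {S Act : Type*} [Fintype S] {G : StochasticGame S Act}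
    {ρ : S → Act → ℝ≥0∞} {v w : S → ℝ≥0∞} {Z : Set S} {s : S} {a : Act}
    (hw : ∀ t ∉ Z, v t = v s → w t = 0) (h : ¬ G.Progresses ρ v Z s a) :
    G.actionValue ρ w s a = 0 := by
  simp only [Progresses, not_or, not_not, not_exists, not_and] at h
  rw [actionValue, h.1, zero_add]
  refine Finset.sum_eq_zero fun t _ => ?_
  by_cases ht : G.trans s a t = 0
  · simp [ht]
  · rw [hw t (h.2 t ht).2 (h.2 t ht).1, mul_zero]

/-- Without progress nothing is earned and `v` is constant over all successors. Contrapositively, an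
action whose value differs from `v s` progresses, so the tie-breaking by progress matters only at
the value `v s`. -/
lemma actionValue_eq_of_not_progresses {S Act : Type*} [Fintype S]
    {G : StochasticGame S Act} {ρ : S → Act → ℝ≥0∞} {v : S → ℝ≥0∞}
    {Z : Set S} {s : S} {a : Act}
    (h : ¬ G.Progresses ρ v Z s a) : G.actionValue ρ v s a = v s := by
  simp only [Progresses, not_or, not_not, not_exists, not_and] at h
  rw [actionValue, h.1, zero_add, ← one_mul (v s), ← PMF.sum_coe (G.trans s a), Finset.sum_mul]
  refine Finset.sum_congr rfl fun t _ => ?_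
  by_cases ht : G.trans s a t = 0
  · simp [ht]
  · rw [(h.2 t ht).1]

lemma actionValue_ne_top {S Act : Type*} [Fintype S] {G : StochasticGame S Act}
    {ρ : S → Act → ℝ≥0∞} {v : S → ℝ≥0∞}
    (hρ : ∀ s a, ρ s a ≠ ∞) (hv : ∀ s, v s ≠ ∞) (s : S) (a : Act) :
    G.actionValue ρ v s a ≠ ∞ :=
  ENNReal.add_ne_top.2 ⟨hρ s a, ENNReal.sum_ne_top.2 fun t _ =>
    ENNReal.mul_ne_top ((G.trans s a).apply_ne_top t) (hv t)⟩

variable {S Act : Type*} [Fintype S] [DecidableEq S] [Fintype Act] (G : StochasticGame S Act)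

lemma sum_actionDist_resolve {S Act : Type*} [DecidableEq S] [Fintype Act] [DecidableEq Act]
    {G : StochasticGame S Act} (θ : G.MultiStrategy)
    {d : {s // s ∈ G.controller} → Finset Act → PMF Act} (hd : G.IsResolution d)
    (π : G.EnvironmentStrategy) (s : {s // s ∈ G.controller}) (f : Act → ℝ≥0∞) :
    ∑ a, G.actionDist (θ.resolve d hd) π s a * f a =
      ∑ B, θ.toFun s B * ∑ a, d s B a * f a := by
  rw [← PMF.sum_bind]
  simp [actionDist, MultiStrategy.resolve]

/-- The expected reward in `s`, followed by `f`, if the controller uses `θ` and all choices are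
resolved in the least favourable way. -/
noncomputable def minStep (ρ : S → Act → ℝ≥0∞) (θ : G.MultiStrategy) :
    (S → ℝ≥0∞) →o (S → ℝ≥0∞) where
  toFun f s := if h : s ∈ G.controller then
    ∑ B, θ.toFun ⟨s, h⟩ B * B.inf (G.actionValue ρ f s) else (G.enabled s).inf (G.actionValue ρ f s)
  monotone' f g hfg s := by
    have hmono : ∀ B : Finset Act, B.inf (G.actionValue ρ f s) ≤ B.inf (G.actionValue ρ g s) :=
      fun B => Finset.inf_mono_fun fun a _ => G.actionValue_mono ρ hfg s a
    dsimp only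
    split_ifs with h
    · gcongr
      exact G.actionValue_mono ρ hfg s _
    · exact hmono _

lemma minStep_controller (ρ : S → Act → ℝ≥0∞) (θ : G.MultiStrategy) (f : S → ℝ≥0∞)
    (s : {s // s ∈ G.controller}) :
    G.minStep ρ θ f s = ∑ B, θ.toFun s B * B.inf (G.actionValue ρ f s) := by
  exact dif_pos s.2

lemma minStep_environment (ρ : S → Act → ℝ≥0∞) (θ : G.MultiStrategy) (f : S → ℝ≥0∞) {s : S}
    (hs : s ∉ G.controller) :
    G.minStep ρ θ f s = (G.enabled s).inf (G.actionValue ρ f s) := by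
  exact dif_neg hs

lemma minStep_le [DecidableEq Act] (ρ : S → Act → ℝ≥0∞) {θ : G.MultiStrategy}
    {σ : G.ControllerStrategy} (hσ : G.Complies σ θ) (π : G.EnvironmentStrategy) (f : S → ℝ≥0∞)
    (s : S) : G.minStep ρ θ f s ≤ ∑ a, G.actionDist σ π s a * G.actionValue ρ f s a := by
  by_cases hs : s ∈ G.controller
  · obtain ⟨d, hd, rfl⟩ := hσ.exists_eq_resolve
    rw [sum_actionDist_resolve θ hd π ⟨s, hs⟩, G.minStep_controller ρ θ f ⟨s, hs⟩]
    refine Finset.sum_le_sum fun B _ => ?_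
    by_cases hB : θ.toFun ⟨s, hs⟩ B = 0
    · simp [hB]
    gcongr
    refine PMF.le_sum_mul _ fun a ha => Finset.inf_le (hd ⟨s, hs⟩ B (θ.enabled _ B hB) ?_ a ha)
    exact Finset.nonempty_iff_ne_empty.2 fun h => hB (h ▸ θ.empty _)
  · rw [G.minStep_environment ρ θ f hs]
    refine PMF.le_sum_mul _ fun a ha => Finset.inf_le (π.enabled ⟨s, hs⟩ a ?_)
    simpa [actionDist, hs] using ha

/-- The minima are over finite sets, so deterministic choices of minimising actions attain them all
at once. -/
lemma exists_strategies_eq_minStep [DecidableEq Act] (ρ : S → Act → ℝ≥0∞) (θ : G.MultiStrategy)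
    (f : S → ℝ≥0∞) : ∃ (σ : G.ControllerStrategy) (π : G.EnvironmentStrategy), G.Complies σ θ ∧
      ∀ s, ∑ a, G.actionDist σ π s a * G.actionValue ρ f s a = G.minStep ρ θ f s := by
  have hmin : ∀ (s : S) (B : Finset Act), ∃ a, B.Nonempty →
      a ∈ B ∧ B.inf (G.actionValue ρ f s) = G.actionValue ρ f s a := by
    intro s B
    by_cases hB : B.Nonempty
    · obtain ⟨a, ha, h⟩ := Finset.exists_mem_eq_inf B hB (G.actionValue ρ f s)
      exact ⟨a, fun _ => ⟨ha, h⟩⟩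
    · obtain ⟨a, -⟩ := G.enabled_nonempty s
      exact ⟨a, fun h => absurd h hB⟩
  choose c hc using hmin
  have hd : G.IsResolution fun s B => PMF.pure (c s B) := by
    intro s B _ hne a ha
    rw [← PMF.mem_support_iff, PMF.mem_support_pure_iff] at ha
    exact ha ▸ (hc s B hne).1
  let π : G.EnvironmentStrategy := ⟨fun s => PMF.pure (c s (G.enabled s)), fun s a ha => by
    rw [← PMF.mem_support_iff, PMF.mem_support_pure_iff] at ha
    exact ha ▸ (hc s _ (G.enabled_nonempty s)).1⟩
  refine ⟨θ.resolve _ hd, π, complies_resolve θ hd, fun s => ?_⟩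
  by_cases hs : s ∈ G.controller
  · rw [sum_actionDist_resolve θ hd π ⟨s, hs⟩, G.minStep_controller ρ θ f ⟨s, hs⟩]
    refine Finset.sum_congr rfl fun B _ => ?_
    rw [PMF.sum_pure]
    rcases B.eq_empty_or_nonempty with rfl | hB
    · simp [θ.empty]
    · rw [(hc s B hB).2]
  · rw [G.minStep_environment ρ θ f hs, (hc s _ (G.enabled_nonempty s)).2]
    simp only [actionDist, hs, dif_neg, not_false_eq_true, π, PMF.sum_pure]

/-- A certificate that every strategy complying with `θ` has at least the expected reward `v`. -/
structure Certificate (ρ : S → Act → ℝ≥0∞) (v : S → ℝ≥0∞) (rank : S → ℕ)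
    (θ : G.MultiStrategy) : Prop where
  ne_top : ∀ s, v s ≠ ∞
  le_controller : ∀ s : {s // s ∈ G.controller},
    v s ≤ ∑ B, θ.toFun s B * B.inf (G.actionValue ρ v s)
  progress_controller : ∀ s : {s // s ∈ G.controller}, v s ≠ 0 →
    ∃ B, θ.toFun s B ≠ 0 ∧ ∀ a ∈ B, G.Progresses ρ v {t | rank t < rank s} s a
  le_environment : ∀ s ∉ G.controller, ∀ a ∈ G.enabled s, v s ≤ G.actionValue ρ v s a
  progress_environment : ∀ s ∉ G.controller, v s ≠ 0 →
    ∀ a ∈ G.enabled s, G.Progresses ρ v {t | rank t < rank s} s a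

lemma Certificate.le_minStep {G : StochasticGame S Act} {ρ : S → Act → ℝ≥0∞} {v : S → ℝ≥0∞}
    {rank : S → ℕ}
    {θ : G.MultiStrategy} (h : G.Certificate ρ v rank θ) (s : S) :
    v s ≤ G.minStep ρ θ v s := by
  by_cases hc : s ∈ G.controller
  · rw [G.minStep_controller ρ θ v ⟨s, hc⟩]
    exact h.le_controller ⟨s, hc⟩
  · rw [G.minStep_environment ρ θ v hc]
    exact Finset.le_inf fun a ha => h.le_environment s hc a ha

lemma exists_certificate [DecidableEq Act] (ρ : S → Act → ℝ≥0∞) (θ : G.MultiStrategy)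
    (hρ : ∀ σ π s, G.expectedReward σ π s ρ ≠ ∞) :
    ∃ v rank, G.Certificate ρ v rank θ ∧
      ∃ σ π, G.Complies σ θ ∧ ∀ s, G.expectedReward σ π s ρ ≤ v s := by
  classical
  set F := G.minStep ρ θ
  set v := F.lfp with hv
  have hFv : F v = v := F.map_lfp
  obtain ⟨σ, π, hσ, hσπ⟩ := G.exists_strategies_eq_minStep ρ θ v
  have hEv : ∀ s, G.expectedReward σ π s ρ ≤ v s :=
    G.expectedReward_le σ π fun s => by rw [hσπ]; exact (congrFun hFv s).le
  -- The rewards under the minimising pair form a pre-fixed point of `F`, so they lie above `v`; in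
  -- particular `v` is finite.
  have hvE : ∀ s, v s ≤ G.expectedReward σ π s ρ := by
    refine F.lfp_le (a := fun s => G.expectedReward σ π s ρ) fun s => ?_
    change F _ s ≤ G.expectedReward σ π s ρ
    rw [G.expectedReward_eq]
    exact G.minStep_le ρ hσ π _ s
  set Φ : Set S → Set S := fun Z => {s | v s ≠ 0 →
    if h : s ∈ G.controller then ∃ B, θ.toFun ⟨s, h⟩ B ≠ 0 ∧ ∀ a ∈ B, G.Progresses ρ v Z s a
    else ∀ a ∈ G.enabled s, G.Progresses ρ v Z s a} with hΦ
  have hprog : ∀ {Z Z' : Set S} s a, Z ⊆ Z' → G.Progresses ρ v Z s a → G.Progresses ρ v Z' s a := by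
    rintro Z Z' s a hZ (h | ⟨t, h1, h2⟩)
    · exact Or.inl h
    · exact Or.inr ⟨t, h1, h2.imp_right fun h => hZ h⟩
  obtain ⟨rank, hrank⟩ := exists_rank_of_forall_subset Φ
    (by
      intro Z Z' hZ s hs h0
      have := hs h0
      split_ifs at this ⊢ with h
      · obtain ⟨B, hB, hB'⟩ := this
        exact ⟨B, hB, fun a ha => hprog s a hZ (hB' a ha)⟩
      · exact fun a ha => hprog s a hZ (this a ha))
    (by
      intro Z hZ
      -- Cutting `v` to zero outside `Z` leaves a pre-fixed point: a state outside `Z`, hence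
      -- outside `Φ Z`, can be forced to earn nothing and to stay among states where `w` vanishes.
      -- Leastness gives `v = 0` outside `Z`, but states with `v = 0` lie in `Φ Z`.
      set w : S → ℝ≥0∞ := fun s => if s ∈ Z then v s else 0 with hw
      have hwv : w ≤ v := fun s => by simp only [hw]; split_ifs <;> simp
      have hFw : F w ≤ w := by
        intro s
        by_cases hs : s ∈ Z
        · calc F w s ≤ F v s := F.monotone hwv s
            _ = w s := by rw [hFv]; simp [hw, hs]
        · refine le_of_eq_of_le ?_ zero_le
          have hw0 : ∀ t ∉ Z, v t = v s → w t = 0 := fun t ht _ => by simp [hw, ht]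
          have hns : s ∉ Φ Z := fun h => hs (hZ h)
          simp only [hΦ, Set.mem_ofPred_eq, Classical.not_imp] at hns
          obtain ⟨-, hns⟩ := hns
          split_ifs at hns with h
          · push Not at hns
            rw [G.minStep_controller ρ θ w ⟨s, h⟩]
            refine Finset.sum_eq_zero fun B _ => ?_
            by_cases hB : θ.toFun ⟨s, h⟩ B = 0
            · simp [hB]
            · obtain ⟨a, ha, hna⟩ := hns B hB
              rw [le_zero_iff.1 ((Finset.inf_le ha).trans_eq (actionValue_eq_zero hw0 hna)),
                mul_zero]
          · push Not at hns
            obtain ⟨a, ha, hna⟩ := hns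
            rw [G.minStep_environment ρ θ w h]
            exact le_zero_iff.1 ((Finset.inf_le ha).trans_eq (actionValue_eq_zero hw0 hna))
      refine Set.eq_univ_of_forall fun s => ?_
      by_contra hs
      have h0 : v s = 0 := le_zero_iff.1 ((F.lfp_le hFw s).trans_eq (by simp [hw, hs]))
      exact hs (hZ fun h => absurd h0 h))
  refine ⟨v, rank, ⟨fun s => ne_top_of_le_ne_top (hρ σ π s) (hvE s), fun s => ?_, fun s h0 => ?_,
    fun s hs a ha => ?_, fun s hs h0 => ?_⟩, σ, π, hσ, hEv⟩
  · rw [← G.minStep_controller ρ θ v s]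
    exact (congrFun hFv s).ge
  · simpa using hrank s h0
  · refine (congrFun hFv s).ge.trans ?_
    rw [G.minStep_environment ρ θ v hs]
    exact Finset.inf_le ha
  · simpa [hs] using hrank s h0

end StochasticGame

namespace StochasticGame

variable {S Act : Type*} [Fintype S] [DecidableEq S] [Fintype Act] [DecidableEq Act]
  {G : StochasticGame S Act} {ρ : S → Act → ℝ≥0∞} {v : S → ℝ≥0∞} {rank : S → ℕ}
  {θ : G.MultiStrategy}

lemma Certificate.exists_progress (h : G.Certificate ρ v rank θ) {σ : G.ControllerStrategy}
    (hσ : G.Complies σ θ) (π : G.EnvironmentStrategy) (s : S) (hs : v s ≠ 0) :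
    ∃ a, G.actionDist σ π s a ≠ 0 ∧ G.Progresses ρ v {t | rank t < rank s} s a := by
  by_cases hc : s ∈ G.controller
  · obtain ⟨d, hd, rfl⟩ := hσ.exists_eq_resolve
    obtain ⟨B, hB, hprog⟩ := h.progress_controller ⟨s, hc⟩ hs
    obtain ⟨a, ha⟩ := (d ⟨s, hc⟩ B).support_nonempty
    rw [PMF.mem_support_iff] at ha
    have hne : B.Nonempty := Finset.nonempty_iff_ne_empty.2 fun h => hB (h ▸ θ.empty _)
    refine ⟨a, ?_, hprog a (hd _ B (θ.enabled _ B hB) hne a ha)⟩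
    simp only [actionDist, hc, dif_pos, MultiStrategy.resolve]
    rw [← PMF.mem_support_iff, PMF.mem_support_bind_iff]
    exact ⟨B, hB, ha⟩
  · obtain ⟨a, ha⟩ := (G.actionDist σ π s).support_nonempty
    rw [PMF.mem_support_iff] at ha
    refine ⟨a, ha, h.progress_environment s hc hs a (π.enabled ⟨s, hc⟩ a ?_)⟩
    simpa [actionDist, hc] using ha

/-- Under any compliant strategy the chain inherits both the inequality and the progress property.
All quantities are finite, so they are moved to the reals, where `le_of_progress` can subtract. -/
lemma Certificate.le_expectedReward (h : G.Certificate ρ v rank θ) {σ : G.ControllerStrategy}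
    (hσ : G.Complies σ θ) (π : G.EnvironmentStrategy)
    (hfin : ∀ s, G.expectedReward σ π s ρ ≠ ∞) (s : S) :
    v s ≤ G.expectedReward σ π s ρ := by
  set x : S → ℝ≥0∞ := fun s => G.expectedReward σ π s ρ with hx
  set P := G.chainMatrix σ π with hP
  set c := G.stepReward σ π ρ with hc
  have hxeq : ∀ s, x s = c s + ∑ t, P s t * x t := fun s => by
    rw [hc, hP, stepReward_add]; exact G.expectedReward_eq σ π s ρ
  have hveq : ∀ s, v s ≤ c s + ∑ t, P s t * v t := fun s => by
    rw [hc, hP, stepReward_add]; exact (h.le_minStep s).trans (G.minStep_le ρ hσ π v s)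
  have hcfin : ∀ s, c s ≠ ∞ := fun s =>
    ne_top_of_le_ne_top (hfin s) (by rw [show G.expectedReward σ π s ρ = x s from rfl, hxeq s]
                                     exact le_self_add)
  have hPfin : ∀ s t, P s t ≠ ∞ := fun s t =>
    ne_top_of_le_ne_top ENNReal.one_ne_top (by
      rw [← G.sum_chainMatrix σ π s]
      exact Finset.single_le_sum (f := P s) (fun _ _ => zero_le) (Finset.mem_univ t))
  have hreal : ∀ y : S → ℝ≥0∞, (∀ s, y s ≠ ∞) → ∀ s, c s + ∑ t, P s t * y t ≠ ∞ ∧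
      (c s + ∑ t, P s t * y t).toReal = (c s).toReal + ∑ t, (P s t).toReal * (y t).toReal := by
    intro y hy s
    have hmul : ∀ t ∈ Finset.univ, P s t * y t ≠ ∞ := fun t _ => ENNReal.mul_ne_top (hPfin s t) (hy t)
    have hsum := ENNReal.sum_ne_top.2 hmul
    refine ⟨ENNReal.add_ne_top.2 ⟨hcfin s, hsum⟩, ?_⟩
    rw [ENNReal.toReal_add (hcfin s) hsum, ENNReal.toReal_sum hmul]
    simp only [ENNReal.toReal_mul]
  rw [← ENNReal.toReal_le_toReal (h.ne_top s) (hfin s)]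
  refine le_of_progress (P := fun s t => (P s t).toReal) (c := fun s => (c s).toReal)
    (x := fun s => (x s).toReal) (v := fun s => (v s).toReal) (rank := rank)
    (fun _ _ => ENNReal.toReal_nonneg) (fun s => ?_) (fun _ => ENNReal.toReal_nonneg)
    (fun _ => ENNReal.toReal_nonneg) (fun s => ?_) (fun s => ?_) (fun s hs => ?_) s
  · rw [← ENNReal.toReal_sum fun t _ => hPfin s t, G.sum_chainMatrix, ENNReal.toReal_one]
  · rw [← (hreal x hfin s).2, ← hxeq]
  · rw [← (hreal v h.ne_top s).2]
    exact ENNReal.toReal_mono (hreal v h.ne_top s).1 (hveq s)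
  · obtain ⟨a, ha, hprog⟩ := h.exists_progress hσ π s (ENNReal.toReal_pos_iff.1 hs).1.ne'
    rcases hprog with hρ | ⟨t, ht, hvt⟩
    · refine Or.inl (ENNReal.toReal_pos ?_ (hcfin s))
      rw [hc, stepReward]
      exact fun h0 => mul_ne_zero ha hρ (Finset.sum_eq_zero_iff.1 h0 a (Finset.mem_univ a))
    · refine Or.inr ⟨t, ENNReal.toReal_pos ?_ (hPfin s t), hvt.imp_left fun hne => ?_⟩
      · rw [hP, chainMatrix]
        exact fun h0 => mul_ne_zero ha ht (Finset.sum_eq_zero_iff.1 h0 a (Finset.mem_univ a))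
      · rwa [Ne, ENNReal.toReal_eq_toReal_iff' (h.ne_top t) (h.ne_top s)]

end StochasticGame

/-! ### Rounding within a prescribed ratio. -/

/-- Weights summing to `1` can be rounded to multiples of `1 / M`, changing them by at most a factor
`1 + η` and increasing only the weight of `top`. -/
lemma exists_nat_weights {α : Type*} [Fintype α] {w : α → ℝ} (hw0 : ∀ a, 0 ≤ w a)
    (hw1 : ∑ a, w a = 1) {top : α} (htop : 0 < w top) {η : ℝ} (hη : 0 < η) {M : ℕ}
    (hM : ∀ a, 0 < w a → (Fintype.card α + 1) * (1 + η) ≤ M * (η * w a)) :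
    ∃ n : α → ℕ, ∑ a, n a = M ∧ (∀ a, (n a : ℝ) ≤ (1 + η) * (M * w a)) ∧
      (∀ a, M * w a ≤ (1 + η) * n a) ∧ ∀ a ≠ top, (n a : ℝ) ≤ M * w a := by
  classical
  have hM0 : (0 : ℝ) ≤ M := M.cast_nonneg
  have hMw : ∀ a, 0 ≤ M * w a := fun a => mul_nonneg hM0 (hw0 a)
  have hfl : ∀ a, (⌊M * w a⌋₊ : ℝ) ≤ M * w a := fun a => Nat.floor_le (hMw a)
  have hfl' : ∀ a, M * w a - 1 ≤ (⌊M * w a⌋₊ : ℝ) := fun a => (Nat.sub_one_lt_floor _).le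
  -- All weights but that of `top` are rounded down and `top` receives the remainder. Each floor
  -- loses at most `1`, so `top` gains at most the cardinality of `α`; `hM` makes both changes
  -- relatively small.
  set R := ∑ a ∈ Finset.univ.erase top, ⌊M * w a⌋₊ with hR
  have hsplit : ∑ a ∈ Finset.univ.erase top, M * w a = M - M * w top := by
    rw [← Finset.mul_sum, Finset.sum_erase_eq_sub (Finset.mem_univ top), hw1]; ring
  have hRle : (R : ℝ) ≤ M - M * w top := by
    rw [hR, Nat.cast_sum, ← hsplit]
    exact Finset.sum_le_sum fun a _ => hfl a
  have hRge : M - M * w top - Fintype.card α ≤ (R : ℝ) := by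
    have h1 : ∑ a ∈ Finset.univ.erase top, (M * w a - 1) ≤ (R : ℝ) := by
      rw [hR, Nat.cast_sum]
      exact Finset.sum_le_sum fun a _ => hfl' a
    rw [Finset.sum_sub_distrib, hsplit, Finset.sum_const, nsmul_eq_mul, mul_one] at h1
    have h2 : ((Finset.univ.erase top).card : ℝ) ≤ Fintype.card α := by
      exact_mod_cast Finset.card_le_univ _
    linarith
  have hRM : R ≤ M := by
    have : (R : ℝ) ≤ M := by linarith [hMw top]
    exact_mod_cast this
  have hcast : ((M - R : ℕ) : ℝ) = M - R := Nat.cast_sub hRM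
  have hcard : (0 : ℝ) ≤ Fintype.card α := Nat.cast_nonneg _
  have hMtop := hM top htop
  refine ⟨fun a => if a = top then M - R else ⌊M * w a⌋₊, ?_, fun a => ?_, fun a => ?_,
    fun a ha => ?_⟩
  · rw [← Finset.add_sum_erase _ _ (Finset.mem_univ top)]
    have : ∑ a ∈ Finset.univ.erase top, (if a = top then M - R else ⌊M * w a⌋₊) = R :=
      Finset.sum_congr rfl fun a ha => if_neg (Finset.ne_of_mem_erase ha)
    rw [this, if_pos rfl]
    omega
  · dsimp only
    split_ifs with h
    · rw [hcast, h]; nlinarith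
    · nlinarith [hfl a, hMw a]
  · dsimp only
    split_ifs with h
    · rw [hcast, h]; nlinarith [hMw top]
    · rcases (hw0 a).eq_or_lt with h0 | h0
      · rw [← h0, mul_zero]; positivity
      · have := hM a h0
        have h2 := mul_le_mul_of_nonneg_left (hfl' a) (by linarith : (0 : ℝ) ≤ 1 + η)
        nlinarith
  · simpa [ha] using hfl a

lemma PMF.exists_eq_div {α : Type*} [Fintype α] {n : α → ℕ} {M : ℕ} (hM : 0 < M)
    (hn : ∑ a, n a = M) : ∃ p : PMF α, ∀ a, p a = (n a : ℝ≥0∞) / M := by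
  refine ⟨PMF.ofFintype (fun a => (n a : ℝ≥0∞) / M) ?_, fun a => rfl⟩
  simp only [div_eq_mul_inv, ← Finset.sum_mul]
  rw [← Nat.cast_sum, hn]
  exact ENNReal.mul_inv_cancel (by simpa using hM.ne') (ENNReal.natCast_ne_top M)

/-- Moving mass to a point with the highest value increases the expectation. -/
lemma PMF.sum_mul_le_of_move {α : Type*} [Fintype α] {p p' : PMF α} {g : α → ℝ≥0∞} {top : α}
    (hg : g top ≠ ∞) (htop : ∀ a, p a ≠ 0 → g a ≤ g top) (hle : ∀ a ≠ top, p' a ≤ p a) :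
    ∑ a, p a * g a ≤ ∑ a, p' a * g a := by
  -- Adding `g top` to both sides, spread over the total masses of `p'` and `p`, replaces
  -- differences of probabilities by a termwise comparison.
  refine (ENNReal.add_le_add_iff_right hg).1 ?_
  calc ∑ a, p a * g a + g top = ∑ a, (p a * g a + p' a * g top) := by
        rw [Finset.sum_add_distrib, ← Finset.sum_mul, PMF.sum_coe, one_mul]
    _ ≤ ∑ a, (p' a * g a + p a * g top) := by
        refine Finset.sum_le_sum fun a _ => ?_
        rcases eq_or_ne a top with rfl | ha
        · rw [add_comm]
        obtain ⟨q, hq⟩ := le_iff_exists_add.1 (hle a ha)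
        rcases eq_or_ne (p a) 0 with h0 | h0
        · simp [h0, le_zero_iff.1 ((hle a ha).trans_eq h0)]
        calc p a * g a + p' a * g top = p' a * g a + (p' a * g top + q * g a) := by rw [hq]; ring
          _ ≤ p' a * g a + (p' a * g top + q * g top) := by gcongr; exact htop a h0
          _ = p' a * g a + p a * g top := by rw [hq]; ring
    _ = ∑ a, p' a * g a + g top := by
        rw [Finset.sum_add_distrib, ← Finset.sum_mul, PMF.sum_coe, one_mul]

/-- For all large `M` a distribution can be rounded to multiples of `1 / M`, changing the
probabilities by at most a given factor and without decreasing a given expectation. -/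
lemma PMF.eventually_exists_round {α : Type*} [Fintype α] (p : PMF α) {g : α → ℝ≥0∞}
    (hg : ∀ a, p a ≠ 0 → g a ≠ ∞) {η : ℝ} (hη : 0 < η) :
    ∀ᶠ M : ℕ in Filter.atTop, ∃ p' : PMF α, (∀ a, ∃ k : ℕ, p' a = (k : ℝ≥0∞) / M) ∧
      (∀ a, p' a ≤ ENNReal.ofReal (1 + η) * p a) ∧ (∀ a, p a ≤ ENNReal.ofReal (1 + η) * p' a) ∧
      ∑ a, p a * g a ≤ ∑ a, p' a * g a := by
  have hlarge : ∀ᶠ M : ℕ in Filter.atTop, ∀ a, 0 < (p a).toReal →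
      (Fintype.card α + 1) * (1 + η) ≤ M * (η * (p a).toReal) := by
    refine Filter.eventually_all.2 fun a => ?_
    by_cases h : 0 < (p a).toReal
    · filter_upwards [(tendsto_natCast_atTop_atTop.atTop_mul_const (mul_pos hη h)).eventually_ge_atTop
        ((Fintype.card α + 1) * (1 + η))] with M hM _ using hM
    · exact Filter.Eventually.of_forall fun M h' => absurd h' h
  filter_upwards [hlarge, Filter.eventually_gt_atTop 0] with M hM hM0
  -- The rounding surplus goes to a point of the support with the greatest `g`, so the expectation
  -- cannot drop.
  obtain ⟨top, htop, hmax⟩ := Set.exists_max_image p.support g (Set.toFinite _) p.support_nonempty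
  have hsum : ∑ a, (p a).toReal = 1 := by
    rw [← ENNReal.toReal_sum fun a _ => p.apply_ne_top a, PMF.sum_coe, ENNReal.toReal_one]
  obtain ⟨n, hn, h1, h2, h3⟩ := exists_nat_weights (fun a => ENNReal.toReal_nonneg) hsum
    (ENNReal.toReal_pos ((p.mem_support_iff _).1 htop) (p.apply_ne_top top)) hη hM
  obtain ⟨p', hp'⟩ := PMF.exists_eq_div hM0 hn
  have hMr : (0 : ℝ) < M := by exact_mod_cast hM0
  have hp'r : ∀ a, p' a = ENNReal.ofReal (n a / M) := fun a => by
    rw [hp', ENNReal.ofReal_div_of_pos hMr, ENNReal.ofReal_natCast, ENNReal.ofReal_natCast]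
  have hpr : ∀ a, p a = ENNReal.ofReal (p a).toReal := fun a =>
    (ENNReal.ofReal_toReal (p.apply_ne_top a)).symm
  refine ⟨p', fun a => ⟨n a, hp' a⟩, fun a => ?_, fun a => ?_,
    PMF.sum_mul_le_of_move (hg top ((p.mem_support_iff _).1 htop)) (fun a ha => hmax a ha)
      fun a ha => ?_⟩
  · rw [hp'r, hpr a, ← ENNReal.ofReal_mul (by positivity)]
    refine ENNReal.ofReal_le_ofReal ?_
    rw [div_le_iff₀ hMr]
    linarith [h1 a]
  · rw [hp'r, hpr a, ← ENNReal.ofReal_mul (by positivity)]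
    refine ENNReal.ofReal_le_ofReal ?_
    rw [← mul_div_assoc, le_div_iff₀ hMr]
    linarith [h2 a]
  · rw [hp'r, hpr a]
    refine ENNReal.ofReal_le_ofReal ?_
    rw [div_le_iff₀ hMr]
    linarith [h3 a ha]

/-- Continuity at `η = 0` when `D` is finite; for `D = ∞` there is nothing to keep small. -/
lemma exists_pos_pow_mul_le (D : ℝ≥0∞) {ε : ℝ} (hε : 0 < ε) (n : ℕ) :
    ∃ η : ℝ, 0 < η ∧ (ENNReal.ofReal (1 + η) ^ 2) ^ n * D ≤ D + ENNReal.ofReal ε := by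
  rcases eq_or_ne D ∞ with rfl | hD
  · exact ⟨1, one_pos, by simp⟩
  have hcont : Continuous fun η : ℝ => ((1 + η) ^ 2) ^ n * D.toReal := by fun_prop
  have hlt : ∀ᶠ η : ℝ in nhds 0, ((1 + η) ^ 2) ^ n * D.toReal < D.toReal + ε :=
    hcont.continuousAt.eventually_lt continuousAt_const (by simpa using hε)
  obtain ⟨η, hη, hη0⟩ := ((hlt.filter_mono nhdsWithin_le_nhds).and
    (self_mem_nhdsWithin : Set.Ioi (0 : ℝ) ∈ nhdsWithin 0 (Set.Ioi 0))).exists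
  have hη0 : 0 < η := hη0
  refine ⟨η, hη0, ?_⟩
  rw [← ENNReal.ofReal_toReal hD, ← ENNReal.ofReal_pow (by positivity),
    ← ENNReal.ofReal_pow (by positivity), ← ENNReal.ofReal_mul (by positivity),
    ← ENNReal.ofReal_add ENNReal.toReal_nonneg hε.le]
  exact ENNReal.ofReal_le_ofReal hη.le

/-! ### Layer-cake formula and stochastic dominance. -/

lemma ENNReal.lintegral_ite_ofReal_lt (y : ℝ≥0∞) :
    ∫⁻ t in Set.Ioi (0 : ℝ), (if ENNReal.ofReal t < y then 1 else 0) = y := by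
  have hmeas : MeasurableSet {t : ℝ | ENNReal.ofReal t < y} :=
    measurableSet_lt (by fun_prop) measurable_const
  have : (fun t : ℝ => if ENNReal.ofReal t < y then (1 : ℝ≥0∞) else 0) =
      {t : ℝ | ENNReal.ofReal t < y}.indicator 1 := by
    funext t; simp [Set.indicator_apply]
  rw [this, lintegral_indicator_one hmeas, Measure.restrict_apply hmeas]
  rcases eq_or_ne y ∞ with rfl | hy
  · simp
  · have : {t : ℝ | ENNReal.ofReal t < y} ∩ Set.Ioi 0 = Set.Ioo 0 y.toReal := by
      ext t
      simp only [Set.mem_inter_iff, Set.mem_ofPred_eq, Set.mem_Ioi, Set.mem_Ioo]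
      constructor
      · rintro ⟨h1, h2⟩
        exact ⟨h2, (ENNReal.ofReal_lt_iff_lt_toReal h2.le hy).1 h1⟩
      · rintro ⟨h1, h2⟩
        exact ⟨(ENNReal.ofReal_lt_iff_lt_toReal h1.le hy).2 h2, h1⟩
    rw [this, Real.volume_Ioo, sub_zero, ENNReal.ofReal_toReal hy]

lemma ENNReal.sum_mul_eq_lintegral {α : Type*} [Fintype α] (p g : α → ℝ≥0∞) :
    ∑ a, p a * g a =
      ∫⁻ t in Set.Ioi (0 : ℝ), ∑ a, p a * (if ENNReal.ofReal t < g a then 1 else 0) := by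
  have hmeas : ∀ y : ℝ≥0∞, Measurable fun t : ℝ =>
      if ENNReal.ofReal t < y then (1 : ℝ≥0∞) else 0 := fun y =>
    Measurable.ite (measurableSet_lt (by fun_prop) measurable_const) measurable_const
      measurable_const
  rw [lintegral_finsetSum _ fun a _ => (hmeas (g a)).const_mul (p a)]
  refine Finset.sum_congr rfl fun a _ => ?_
  rw [lintegral_const_mul _ (hmeas (g a)), ENNReal.lintegral_ite_ofReal_lt]

/-- Stochastic dominance implies the inequality of the expectations. -/
lemma ENNReal.sum_mul_le_of_dominated {α β : Type*} [Fintype α] [Fintype β] {p : α → ℝ≥0∞}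
    {q : β → ℝ≥0∞} {g : α → ℝ≥0∞} {g' : β → ℝ≥0∞}
    (h : ∀ t : ℝ≥0∞, t ≠ ∞ → ∑ a, p a * (if t < g a then 1 else 0) ≤
      ∑ b, q b * (if t < g' b then 1 else 0)) :
    ∑ a, p a * g a ≤ ∑ b, q b * g' b := by
  rw [ENNReal.sum_mul_eq_lintegral, ENNReal.sum_mul_eq_lintegral]
  exact lintegral_mono fun t => h _ ENNReal.ofReal_ne_top

lemma Fin.sum_ite_lt_div {m n : ℕ} (hn : n ≤ m + 1) :
    ∑ i : Fin (m + 1), ((m + 1 : ℕ) : ℝ≥0∞)⁻¹ * (if (i : ℕ) < n then 1 else 0) =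
      (n : ℝ≥0∞) / (m + 1 : ℕ) := by
  rw [← Finset.mul_sum, Finset.sum_boole, mul_comm, div_eq_mul_inv]
  congr 2
  rw [Fin.card_filter_val_lt]
  omega

/-! ### Rounding a random set to nested sets. -/

section Penalty

variable {Act : Type*} [Fintype Act] [DecidableEq Act]

/-- The expected total weight of the actions in `A` missing from a random set. -/
lemma sum_powerset_sdiff {A : Finset Act} {p : PMF (Finset Act)}
    (hpA : ∀ B, p B ≠ 0 → B ⊆ A) (ψ : Act → ℝ≥0) :
    ∑ B ∈ A.powerset, ∑ a ∈ A \ B, p B * (ψ a : ℝ≥0∞) =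
      ∑ a ∈ A, (∑ B, p B * (if a ∈ B then 0 else 1)) * ψ a := by
  simp only [Finset.sum_mul]
  rw [Finset.sum_comm (s := A)]
  rw [Finset.sum_subset (Finset.subset_univ A.powerset)]
  · refine Finset.sum_congr rfl fun B _ => ?_
    rw [Finset.sdiff_eq_filter, Finset.sum_filter]
    refine Finset.sum_congr rfl fun a _ => ?_
    by_cases h : a ∈ B <;> simp [h]
  · intro B _ hB
    have : p B = 0 := by
      by_contra h
      exact hB (Finset.mem_powerset.2 (hpA B h))
    simp [this]

/-- A random subset of `A` can be rounded to probabilities that are multiples of `1 / M` such that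
the expected least value of `f` does not decrease, `good` sets keep a positive probability, and the
probability of missing an action of `A` increases by at most `1 / M`. -/
lemma PMF.exists_round_subset {A : Finset Act} (hA : A.Nonempty) (p : PMF (Finset Act))
    (hp0 : p ∅ = 0) (hpA : ∀ B, p B ≠ 0 → B ⊆ A) {f : Act → ℝ≥0∞} {good : Act → Prop} {x : ℝ≥0∞}
    (hxtop : x ≠ ∞) (hx : x ≤ ∑ B, p B * B.inf f) (hfx : ∀ a, f a ≠ x → good a) {M : ℕ}
    (hM : 0 < M) :
    ∃ p' : PMF (Finset Act), p' ∅ = 0 ∧ (∀ B, p' B ≠ 0 → B ⊆ A) ∧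
      (∀ B, ∃ k : ℕ, p' B = (k : ℝ≥0∞) / M) ∧ ∑ B, p B * B.inf f ≤ ∑ B, p' B * B.inf f ∧
      ((∃ B, p B ≠ 0 ∧ ∀ a ∈ B, good a) → ∃ B, p' B ≠ 0 ∧ ∀ a ∈ B, good a) ∧
      ∀ a ∈ A, ∑ B, p' B * (if a ∈ B then 0 else 1) ≤
        ∑ B, p B * (if a ∈ B then 0 else 1) + (M : ℝ≥0∞)⁻¹ := by
  classical
  obtain ⟨m, rfl⟩ : ∃ m, M = m + 1 := ⟨M - 1, by omega⟩
  have hMtop : ((m + 1 : ℕ) : ℝ≥0∞) ≠ ∞ := ENNReal.natCast_ne_top _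
  have hM0 : ((m + 1 : ℕ) : ℝ≥0∞) ≠ 0 := by simp
  have hpne : ∀ B, p B ≠ 0 → B.Nonempty := fun B hB =>
    Finset.nonempty_iff_ne_empty.2 fun h => hB (h ▸ hp0)
  -- Lexicographic key: value first, then `good` above not `good`. Maximising the least key serves
  -- both the expected value and the survival of a good set.
  let k : Act → ℝ≥0∞ ×ₗ ℕ := fun a => toLex (f a, if good a then 1 else 0)
  have hkf : ∀ {a c}, k a ≤ k c → f a ≤ f c := fun {a c} h => by
    rcases Prod.Lex.toLex_le_toLex.1 h with h | h
    exacts [h.le, h.1.le]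
  have hkgood : ∀ {a c}, k a ≤ k c → f a = f c → good a → good c := fun {a c} h hac ha => by
    rcases Prod.Lex.toLex_le_toLex.1 h with h | h
    · exact absurd hac h.ne
    · by_contra hc
      simp [ha, hc] at h
  -- the probability that all available actions have a larger key than `a`
  let T : Act → ℝ≥0∞ := fun a => ∑ B, p B * (if ∀ c ∈ B, k a < k c then 1 else 0)
  have hT1 : ∀ a, T a ≤ 1 := fun a => by
    rw [← PMF.sum_coe p]
    exact Finset.sum_le_sum fun B _ => mul_le_of_le_one_right' (by split_ifs <;> simp)
  have hTanti : ∀ {a c}, k a ≤ k c → T c ≤ T a := fun {a c} h => by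
    refine Finset.sum_le_sum fun B _ => mul_le_mul_right ?_ _
    split_ifs with h1 h2
    · exact le_rfl
    · exact absurd (fun b hb => h.trans_lt (h1 b hb)) h2
    all_goals exact zero_le
  let N : Act → ℕ := fun a => ⌈((m + 1 : ℕ) * T a).toReal⌉₊
  have hMT : ∀ a, ((m + 1 : ℕ) : ℝ≥0∞) * T a ≠ ∞ := fun a =>
    ENNReal.mul_ne_top hMtop (ne_top_of_le_ne_top ENNReal.one_ne_top (hT1 a))
  have hNanti : ∀ {a c}, k a ≤ k c → N c ≤ N a := fun h =>
    Nat.ceil_mono (ENNReal.toReal_mono (hMT _) (mul_le_mul_right (hTanti h) _))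
  have hNle : ∀ a, N a ≤ m + 1 := fun a => by
    refine Nat.ceil_le.2 ?_
    rw [← ENNReal.toReal_natCast (m + 1)]
    exact ENNReal.toReal_mono hMtop (mul_le_of_le_one_right' (hT1 a))
  have hTN : ∀ a, T a ≤ (N a : ℝ≥0∞) / (m + 1 : ℕ) := fun a => by
    rw [ENNReal.le_div_iff_mul_le (Or.inl hM0) (Or.inl hMtop), mul_comm,
      ← ENNReal.ofReal_toReal (hMT a), ← ENNReal.ofReal_natCast (N a)]
    exact ENNReal.ofReal_le_ofReal (Nat.le_ceil _)
  have hNT : ∀ a, (N a : ℝ≥0∞) / (m + 1 : ℕ) ≤ T a + ((m + 1 : ℕ) : ℝ≥0∞)⁻¹ := fun a => by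
    rw [ENNReal.div_le_iff hM0 hMtop, add_mul, ENNReal.inv_mul_cancel hM0 hMtop, mul_comm (T a),
      ← ENNReal.ofReal_toReal (hMT a), ← ENNReal.ofReal_natCast (N a), ← ENNReal.ofReal_one,
      ← ENNReal.ofReal_add ENNReal.toReal_nonneg zero_le_one]
    exact ENNReal.ofReal_le_ofReal (Nat.ceil_lt_add_one ENNReal.toReal_nonneg).le
  -- Upper sets of the key order, growing with `i`. Under a uniform index, `a` is missed for exactly
  -- the `N a` indices below `N a`, that is, with probability `T a` rounded up to a multiple of `1 /
  -- M`.
  let C : Fin (m + 1) → Finset Act := fun i => A.filter fun a => N a ≤ i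
  -- An action of greatest key has `T a₁ = 0`, so it lies in every `C i`, and none of these sets is
  -- empty.
  obtain ⟨a₁, ha₁, hmax⟩ := Finset.exists_max_image A k hA
  have hN₁ : N a₁ = 0 := by
    have : T a₁ = 0 := Finset.sum_eq_zero fun B _ => by
      by_cases hB : p B = 0
      · simp [hB]
      obtain ⟨c, hc⟩ := hpne B hB
      rw [if_neg fun h => (h c hc).not_ge (hmax c (hpA B hB hc)), mul_zero]
    simp [N, this]
  have hCne : ∀ i, (C i).Nonempty := fun i => ⟨a₁, by simp [C, ha₁, hN₁]⟩
  have hsum : ∀ g : Finset Act → ℝ≥0∞,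
      ∑ B, ((PMF.uniformOfFintype (Fin (m + 1))).map C) B * g B =
        ∑ i, ((m + 1 : ℕ) : ℝ≥0∞)⁻¹ * g (C i) := fun g => by
    rw [PMF.sum_map]; simp
  have hsupp : ∀ B, ((PMF.uniformOfFintype (Fin (m + 1))).map C) B ≠ 0 ↔ ∃ i, C i = B := fun B => by
    rw [← PMF.mem_support_iff]; simp
  refine ⟨(PMF.uniformOfFintype (Fin (m + 1))).map C, ?_, fun B hB => ?_, fun B => ?_, ?_, ?_,
    fun a ha => ?_⟩
  · by_contra h
    obtain ⟨i, hi⟩ := (hsupp _).1 h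
    exact (hCne i).ne_empty hi
  · obtain ⟨i, rfl⟩ := (hsupp _).1 hB
    exact Finset.filter_subset _ _
  · refine ⟨(Finset.univ.filter fun i => C i = B).card, ?_⟩
    have h := hsum fun B' => if B' = B then 1 else 0
    simp only [mul_ite, mul_one, mul_zero, Finset.sum_ite_eq', Finset.mem_univ, if_true] at h
    rw [h, ← Finset.sum_filter, Finset.sum_const, nsmul_eq_mul, div_eq_mul_inv]
  · rw [hsum]
    refine ENNReal.sum_mul_le_of_dominated fun t ht => ?_
    by_cases hlow : (A.filter fun a => f a ≤ t).Nonempty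
    -- Let `b` have the greatest key among actions of value at most `t`. A set with least value
    -- above `t` has all keys above `k b`, so the left side is at most `T b`. For `i < N b` the set
    -- `C i` contains no action of value at most `t`, so the right side is at least `N b / M`.
    · obtain ⟨b, hb, hbmax⟩ := Finset.exists_max_image _ k hlow
      simp only [Finset.mem_filter] at hb hbmax
      refine le_trans ?_ ((hTN b).trans ?_)
      · refine Finset.sum_le_sum fun B _ => mul_le_mul_right ?_ _
        split_ifs with h1 h2
        · exact le_rfl
        · refine absurd (fun c hc => ?_) h2
          by_contra hbc
          exact (h1.trans_le (Finset.inf_le hc)).not_ge ((hkf (not_lt.1 hbc)).trans hb.2)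
        all_goals exact zero_le
      · rw [← Fin.sum_ite_lt_div (hNle b)]
        refine Finset.sum_le_sum fun i _ => mul_le_mul_right ?_ _
        split_ifs with h1 h2
        · exact le_rfl
        · refine absurd ((Finset.lt_inf_iff (lt_top_iff_ne_top.2 ht)).2 fun c hc => ?_) h2
          simp only [C, Finset.mem_filter] at hc
          by_contra hct
          exact absurd (hNanti (hbmax c ⟨hc.1, not_lt.1 hct⟩)) (by omega)
        all_goals exact zero_le
    · have hlt : ∀ i, t < (C i).inf f := fun i => by
        refine (Finset.lt_inf_iff (lt_top_iff_ne_top.2 ht)).2 fun c hc => ?_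
        by_contra hct
        exact hlow ⟨c, Finset.mem_filter.2 ⟨Finset.filter_subset _ _ hc, not_lt.1 hct⟩⟩
      have hterm : ∀ i, ((m + 1 : ℕ) : ℝ≥0∞)⁻¹ * (if t < (C i).inf f then 1 else 0) =
          ((m + 1 : ℕ) : ℝ≥0∞)⁻¹ := fun i => by rw [if_pos (hlt i), mul_one]
      have hone : ∑ i, ((m + 1 : ℕ) : ℝ≥0∞)⁻¹ * (if t < (C i).inf f then 1 else 0) = 1 := by
        rw [Finset.sum_congr rfl fun i _ => hterm i, Finset.sum_const,
          Finset.card_univ, Fintype.card_fin, nsmul_eq_mul]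
        exact ENNReal.mul_inv_cancel hM0 hMtop
      rw [hone]
      refine (Finset.sum_le_sum fun B _ => ?_).trans_eq (PMF.sum_coe p)
      exact mul_le_of_le_one_right' (by split_ifs <;> simp)
  · rintro ⟨B, hB, hgood⟩
    -- Some possible set has a least-key element `b` with value above `x`, or with value `x` and
    -- good. Otherwise all least values would be at most `x`, and strictly less on the good set `B`,
    -- so their average would be below `x`.
    obtain ⟨B₀, hB₀, b, -, hbmin, hb⟩ : ∃ B₀, p B₀ ≠ 0 ∧ ∃ b ∈ B₀, (∀ c ∈ B₀, k b ≤ k c) ∧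
        (x < f b ∨ x = f b ∧ good b) := by
      by_contra! hno
      have hle : ∀ B, p B ≠ 0 → B.inf f ≤ x := fun B hB => by
        obtain ⟨b, hb, hbmin⟩ := Finset.exists_min_image B k (hpne B hB)
        exact (Finset.inf_le hb).trans (hno B hB b hb hbmin).1
      have hlt : B.inf f < x := by
        obtain ⟨b, hb, hbmin⟩ := Finset.exists_min_image B k (hpne B hB)
        have h := hno B hB b hb hbmin
        exact (Finset.inf_le hb).trans_lt
          (h.1.lt_of_ne fun h' => h.2 h'.symm (hgood b hb))
      refine absurd hx (not_le.2 ?_)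
      have hmul : ∀ B', p B' * B'.inf f ≤ p B' * x := fun B' => by
        by_cases h : p B' = 0
        · simp [h]
        · gcongr
          exact hle B' h
      have hrest : ∑ B' ∈ Finset.univ.erase B, p B' * x ≠ ∞ :=
        ENNReal.sum_ne_top.2 fun B' _ => ENNReal.mul_ne_top (p.apply_ne_top B') hxtop
      calc ∑ B', p B' * B'.inf f
          = ∑ B' ∈ Finset.univ.erase B, p B' * B'.inf f + p B * B.inf f :=
            (Finset.sum_erase_add _ _ (Finset.mem_univ B)).symm
        _ ≤ ∑ B' ∈ Finset.univ.erase B, p B' * x + p B * B.inf f := by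
            gcongr ?_ + _
            exact Finset.sum_le_sum fun B' _ => hmul B'
        _ < ∑ B' ∈ Finset.univ.erase B, p B' * x + p B * x :=
            ENNReal.add_lt_add_left hrest (ENNReal.mul_lt_mul_right hB (p.apply_ne_top B) hlt)
        _ = x := by
            rw [Finset.sum_erase_add _ _ (Finset.mem_univ B), ← Finset.sum_mul, PMF.sum_coe,
              one_mul]
    -- Members of `C 0` have `T c = 0`, so `B₀` cannot lie strictly above them. Hence their keys are
    -- at least `k b`, which makes them good.
    refine ⟨C 0, (hsupp _).2 ⟨0, rfl⟩, fun c hc => ?_⟩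
    simp only [C, Finset.mem_filter, Fin.val_zero, Nat.le_zero] at hc
    have hTc : T c = 0 := by
      refine le_zero_iff.1 ((hTN c).trans_eq ?_)
      rw [hc.2]; simp
    have hbc : k b ≤ k c := by
      by_contra hcb
      have h0 := Finset.sum_eq_zero_iff.1 hTc B₀ (Finset.mem_univ _)
      rw [if_pos fun c' hc' => (not_le.1 hcb).trans_le (hbmin c' hc'), mul_one] at h0
      exact hB₀ h0
    rcases hb with hb | ⟨hb, hgb⟩
    · exact hfx c (hb.trans_le (hkf hbc)).ne'
    · by_cases hfc : f c = x
      · exact hkgood hbc (hb.symm.trans hfc.symm) hgb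
      · exact hfx c hfc
  · rw [hsum]
    have : ∀ i : Fin (m + 1), (if a ∈ C i then (0 : ℝ≥0∞) else 1) = if (i : ℕ) < N a then 1 else 0 :=
      fun i => by by_cases h : (i : ℕ) < N a <;> simp [C, ha, h]
    simp only [this]
    rw [Fin.sum_ite_lt_div (hNle a)]
    refine (hNT a).trans ?_
    gcongr ?_ + _
    -- If all keys in `B` exceed `k a`, then `a` is not in `B`; so `T a` is at most the probability
    -- of missing `a`.
    refine Finset.sum_le_sum fun B _ => mul_le_mul_right ?_ _
    by_cases haB : a ∈ B
    · rw [if_neg fun h => (h a haB).false]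
      exact zero_le
    · rw [if_neg haB]
      split_ifs <;> simp

end Penalty

/-! ### Sound rounded multi-strategies and their penalties. -/

namespace StochasticGame

variable {S Act : Type*} [Fintype S] [DecidableEq S] [Fintype Act] [DecidableEq Act]
  (G : StochasticGame S Act)

lemma Sound.exists_certificate {G : StochasticGame S Act} {r : S → Act → ℝ≥0} {b : ℝ}
    {θ : G.MultiStrategy} (hθ : G.Sound r b θ)
    (hfin : ∀ σ π s, G.expectedReward σ π s (fun t a => (r t a : ℝ≥0∞)) ≠ ∞) :
    ∃ v rank, G.Certificate (fun t a => (r t a : ℝ≥0∞)) v rank θ ∧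
      ENNReal.ofReal b ≤ v G.init := by
  obtain ⟨v, rank, hv, σ, π, hσ, hle⟩ := G.exists_certificate _ θ hfin
  exact ⟨v, rank, hv, (hθ σ hσ π).trans (hle G.init)⟩

lemma Certificate.sound {G : StochasticGame S Act} {r : S → Act → ℝ≥0} {b : ℝ}
    {θ : G.MultiStrategy} {v : S → ℝ≥0∞} {rank : S → ℕ}
    (h : G.Certificate (fun t a => (r t a : ℝ≥0∞)) v rank θ)
    (hfin : ∀ σ π s, G.expectedReward σ π s (fun t a => (r t a : ℝ≥0∞)) ≠ ∞)
    (hb : ENNReal.ofReal b ≤ v G.init) : G.Sound r b θ :=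
  fun σ hσ π => hb.trans (h.le_expectedReward hσ π (hfin σ π) G.init)

/-- A certificate stays valid if the distributions over allowed sets change suitably. -/
lemma Certificate.of_le {S Act : Type*} [Fintype S] [Fintype Act]
    {G : StochasticGame S Act} {ρ : S → Act → ℝ≥0∞} {v : S → ℝ≥0∞}
    {rank : S → ℕ} {θ θ' : G.MultiStrategy} (h : G.Certificate ρ v rank θ)
    (hle : ∀ s : {s // s ∈ G.controller}, ∑ B, θ.toFun s B * B.inf (G.actionValue ρ v s) ≤
      ∑ B, θ'.toFun s B * B.inf (G.actionValue ρ v s))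
    (hprog : ∀ s : {s // s ∈ G.controller}, v s ≠ 0 →
      (∃ B, θ.toFun s B ≠ 0 ∧ ∀ a ∈ B, G.Progresses ρ v {t | rank t < rank s} s a) →
      ∃ B, θ'.toFun s B ≠ 0 ∧ ∀ a ∈ B, G.Progresses ρ v {t | rank t < rank s} s a) :
    G.Certificate ρ v rank θ' where
  ne_top := h.ne_top
  le_controller s := (h.le_controller s).trans (hle s)
  progress_controller s hs := hprog s hs (h.progress_controller s hs)
  le_environment := h.le_environment
  progress_environment := h.progress_environment

lemma localPenalty_eq {S Act : Type*} [Fintype Act] [DecidableEq Act]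
    (G : StochasticGame S Act) (ψ : {s // s ∈ G.controller} → Act → ℝ≥0) (θ : G.MultiStrategy)
    (s : {s // s ∈ G.controller}) : G.localPenalty ψ θ s =
      ∑ a ∈ G.enabled s, (∑ B, θ.toFun s B * (if a ∈ B then 0 else 1)) * ψ s a :=
  sum_powerset_sdiff (θ.enabled s) (ψ s)

lemma exists_sound_static (r : S → Act → ℝ≥0) (b : ℝ)
    (hfin : ∀ σ π s, G.expectedReward σ π s (fun t a => (r t a : ℝ≥0∞)) ≠ ∞)
    (ψ : {s // s ∈ G.controller} → Act → ℝ≥0) {θ : G.MultiStrategy} (hθ : G.Sound r b θ)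
    {ε : ℝ} {M : ℕ} (hM : 0 < M)
    (hMε : ∑ s : {s // s ∈ G.controller}, ∑ a ∈ G.enabled s, (ψ s a : ℝ) ≤ M * ε) :
    ∃ θ' : G.MultiStrategy, θ'.HasGranularity M ∧ G.Sound r b θ' ∧
      G.staticPenalty ψ θ' ≤ G.staticPenalty ψ θ + ENNReal.ofReal ε := by
  obtain ⟨v, rank, hv, hb⟩ := hθ.exists_certificate hfin
  have hround := fun s : {s // s ∈ G.controller} =>
    PMF.exists_round_subset (G.enabled_nonempty s) (θ.toFun s) (θ.empty s) (θ.enabled s)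
      (good := G.Progresses (fun t a => (r t a : ℝ≥0∞)) v {t | rank t < rank s} s)
      (hv.ne_top s) (hv.le_controller s)
      (fun a ha => by_contra fun h => ha (actionValue_eq_of_not_progresses h)) hM
  choose p hp0 hpA hgran hle hprog hpen using hround
  refine ⟨⟨p, hp0, hpA⟩, ⟨hM, hgran⟩, (hv.of_le hle fun s _ => hprog s).sound hfin hb, ?_⟩
  simp only [staticPenalty, localPenalty_eq]
  calc ∑ s : {s // s ∈ G.controller}, ∑ a ∈ G.enabled s,
        (∑ B, p s B * (if a ∈ B then 0 else 1)) * (ψ s a : ℝ≥0∞)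
      ≤ ∑ s : {s // s ∈ G.controller}, ∑ a ∈ G.enabled s,
        (∑ B, θ.toFun s B * (if a ∈ B then 0 else 1) + (M : ℝ≥0∞)⁻¹) * (ψ s a : ℝ≥0∞) :=
        Finset.sum_le_sum fun s _ => Finset.sum_le_sum fun a ha => by
          gcongr
          exact hpen s a ha
    _ = ∑ s : {s // s ∈ G.controller}, ∑ a ∈ G.enabled s,
          (∑ B, θ.toFun s B * (if a ∈ B then 0 else 1)) * (ψ s a : ℝ≥0∞) +
        (M : ℝ≥0∞)⁻¹ * ∑ s : {s // s ∈ G.controller}, ∑ a ∈ G.enabled s, (ψ s a : ℝ≥0∞) := by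
        simp only [add_mul, Finset.sum_add_distrib, Finset.mul_sum]
    _ ≤ _ := by
        gcongr
        have hcast : ∑ s : {s // s ∈ G.controller}, ∑ a ∈ G.enabled s, (ψ s a : ℝ≥0∞) =
            ENNReal.ofReal (∑ s : {s // s ∈ G.controller}, ∑ a ∈ G.enabled s, (ψ s a : ℝ)) := by
          have h := ENNReal.ofReal_coe_nnreal
            (p := ∑ s : {s // s ∈ G.controller}, ∑ a ∈ G.enabled s, ψ s a)
          push_cast at h
          exact h.symm
        rw [hcast, mul_comm, ← div_eq_mul_inv]
        refine ENNReal.div_le_of_le_mul ?_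
        rw [mul_comm, ← ENNReal.ofReal_natCast, ← ENNReal.ofReal_mul (Nat.cast_nonneg M)]
        exact ENNReal.ofReal_le_ofReal hMε

lemma stepReward_penaltyReward {S Act : Type*} [DecidableEq S] [Fintype Act] [DecidableEq Act]
    (G : StochasticGame S Act) (ψ : {s // s ∈ G.controller} → Act → ℝ≥0) (θ : G.MultiStrategy)
    (σ : G.ControllerStrategy) (π : G.EnvironmentStrategy) (s : S) :
    G.stepReward σ π (G.penaltyReward ψ θ) s =
      if h : s ∈ G.controller then G.localPenalty ψ θ ⟨s, h⟩ else 0 := by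
  simp only [stepReward, penaltyReward]
  rw [← Finset.sum_mul, PMF.sum_coe, one_mul]

/-- Changing the probabilities of a multi-strategy by at most a factor `L` changes the transition
probabilities under a fixed resolution of its choices by at most a factor `L`. -/
lemma chainMatrix_resolve_le {S Act : Type*} [DecidableEq S] [Fintype Act] [DecidableEq Act]
    {G : StochasticGame S Act} {θ θ' : G.MultiStrategy} {L : ℝ≥0∞}
    (hL : 1 ≤ L) (hle : ∀ s B, θ'.toFun s B ≤ L * θ.toFun s B)
    {d : {s // s ∈ G.controller} → Finset Act → PMF Act} (hd : G.IsResolution d)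
    (π : G.EnvironmentStrategy) (s t : S) :
    G.chainMatrix (θ'.resolve d hd) π s t ≤ L * G.chainMatrix (θ.resolve d hd) π s t := by
  by_cases hs : s ∈ G.controller
  · rw [chainMatrix, chainMatrix, sum_actionDist_resolve θ hd π ⟨s, hs⟩ fun a => G.trans s a t,
      sum_actionDist_resolve θ' hd π ⟨s, hs⟩ fun a => G.trans s a t, Finset.mul_sum]
    refine Finset.sum_le_sum fun B _ => ?_
    rw [← mul_assoc]
    gcongr
    exact hle _ B
  · refine le_trans (le_of_eq ?_) (le_mul_of_one_le_left' hL)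
    simp only [chainMatrix, actionDist, hs, dif_neg, not_false_eq_true]

/-- One resolution `d` applied to `θ'` and `θ` yields two Markov chains whose transition
probabilities, in both directions, and local penalties differ by at most `L`, so
`chainReward_le_of_ratio` applies for each `d` and `π`, also when the penalty is infinite. -/
lemma dynamicPenalty_le {G : StochasticGame S Act} (ψ : {s // s ∈ G.controller} → Act → ℝ≥0)
    {θ θ' : G.MultiStrategy} {L : ℝ≥0∞} (hL : 1 ≤ L)
    (hle : ∀ s B, θ'.toFun s B ≤ L * θ.toFun s B) (hge : ∀ s B, θ.toFun s B ≤ L * θ'.toFun s B) :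
    G.dynamicPenalty ψ θ' ≤ (L ^ 2) ^ Fintype.card S * G.dynamicPenalty ψ θ := by
  refine iSup₂_le fun σ hσ => iSup_le fun π => ?_
  obtain ⟨d, hd, rfl⟩ := hσ.exists_eq_resolve
  have hmono : G.expectedReward (θ.resolve d hd) π G.init (G.penaltyReward ψ θ) ≤
      G.dynamicPenalty ψ θ :=
    le_iSup_of_le (θ.resolve d hd) <| le_iSup_of_le (complies_resolve θ hd) <|
      le_iSup (fun π => G.expectedReward (θ.resolve d hd) π G.init (G.penaltyReward ψ θ)) π
  refine le_trans ?_ (mul_le_mul_right hmono _)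
  rw [expectedReward_eq_chainReward, expectedReward_eq_chainReward]
  refine chainReward_le_of_ratio hL (G.sum_chainMatrix _ π) (G.sum_chainMatrix _ π)
    (chainMatrix_resolve_le hL hle hd π) (chainMatrix_resolve_le hL hge hd π) (fun s => ?_) _
  rw [stepReward_penaltyReward, stepReward_penaltyReward]
  split_ifs with hs
  · simp only [localPenalty, Finset.mul_sum, ← mul_assoc]
    gcongr
    exact hle _ _
  · exact zero_le

/-- The two-sided ratio bound does double duty: it controls the penalty, and it preserves supports,
so the progressing sets of the certificate remain possible. -/
lemma exists_sound_dynamic (r : S → Act → ℝ≥0) (b : ℝ)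
    (hfin : ∀ σ π s, G.expectedReward σ π s (fun t a => (r t a : ℝ≥0∞)) ≠ ∞)
    (ψ : {s // s ∈ G.controller} → Act → ℝ≥0) {θ : G.MultiStrategy} (hθ : G.Sound r b θ)
    {ε : ℝ} (hε : 0 < ε) :
    ∃ (M : ℕ) (θ' : G.MultiStrategy), θ'.HasGranularity M ∧ G.Sound r b θ' ∧
      G.dynamicPenalty ψ θ' ≤ G.dynamicPenalty ψ θ + ENNReal.ofReal ε := by
  obtain ⟨v, rank, hv, hb⟩ := hθ.exists_certificate hfin
  obtain ⟨η, hη, hηε⟩ := exists_pos_pow_mul_le (G.dynamicPenalty ψ θ) hε (Fintype.card S)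
  have hround := Filter.eventually_all.2 fun s : {s // s ∈ G.controller} =>
    PMF.eventually_exists_round (θ.toFun s)
      (g := fun B => B.inf (G.actionValue (fun t a => (r t a : ℝ≥0∞)) v s))
      (fun B hB => by
        have hne : B ≠ ∅ := fun h => hB (h ▸ θ.empty s)
        obtain ⟨a, ha⟩ := Finset.nonempty_iff_ne_empty.2 hne
        exact ne_top_of_le_ne_top
          (actionValue_ne_top (fun _ _ => ENNReal.coe_ne_top) hv.ne_top s a) (Finset.inf_le ha)) hη
  obtain ⟨M, hM, hM0⟩ := (hround.and (Filter.eventually_gt_atTop 0)).exists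
  choose p hgran hle hge hval using hM
  have hsupp : ∀ s B, p s B ≠ 0 → θ.toFun s B ≠ 0 := fun s B hB h =>
    hB (le_zero_iff.1 ((hle s B).trans_eq (by rw [h, mul_zero])))
  refine ⟨M, ⟨p, fun s => not_not.1 fun h => hsupp s ∅ h (θ.empty s),
    fun s B hB => θ.enabled s B (hsupp s B hB)⟩, ⟨hM0, hgran⟩,
    (hv.of_le hval fun s _ => ?_).sound hfin hb, ?_⟩
  · rintro ⟨B, hB, hprog⟩
    exact ⟨B, fun h => hB (le_zero_iff.1 ((hge s B).trans_eq
      (by rw [show p s B = 0 from h, mul_zero]))), hprog⟩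
  · exact (dynamicPenalty_le ψ (ENNReal.one_le_ofReal.2 (by linarith)) hle hge).trans hηε

end StochasticGame

theorem mainTheorem9 {S Act : Type*} [Fintype S] [DecidableEq S] [Fintype Act] [DecidableEq Act]
    (G : StochasticGame S Act) (r : S → Act → ℝ≥0) (b : ℝ)
    (hr : ∀ s : S, (⨆ (σ : G.ControllerStrategy) (π : G.EnvironmentStrategy),
      G.expectedReward σ π s (fun t a => (r t a : ℝ≥0∞))) < ∞)
    (ψ : {s // s ∈ G.controller} → Act → ℝ≥0)
    (θ : G.MultiStrategy) (hθ : G.Sound r b θ) (ε : ℝ) (hε : 0 < ε) :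
    (∀ τ : PenaltyType, ∃ (M : ℕ) (θ' : G.MultiStrategy), θ'.HasGranularity M ∧ G.Sound r b θ' ∧
      G.penalty ψ τ θ' ≤ G.penalty ψ τ θ + ENNReal.ofReal ε) ∧
    (∃ θ' : G.MultiStrategy,
      θ'.HasGranularity (max 1 ⌈∑ s : {s // s ∈ G.controller}, ∑ a ∈ G.enabled s,
        (ψ s a : ℝ) / ε⌉₊) ∧
      G.Sound r b θ' ∧
      G.penalty ψ .sta θ' ≤ G.penalty ψ .sta θ + ENNReal.ofReal ε) := by
  have hfin : ∀ σ π s, G.expectedReward σ π s (fun t a => (r t a : ℝ≥0∞)) ≠ ∞ := fun σ π s =>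
    ne_top_of_le_ne_top (hr s).ne (le_iSup₂ (f := fun (σ : G.ControllerStrategy)
      (π : G.EnvironmentStrategy) => G.expectedReward σ π s fun t a => (r t a : ℝ≥0∞)) σ π)
  have hsta := G.exists_sound_static r b hfin ψ hθ (ε := ε)
    (M := max 1 ⌈∑ s : {s // s ∈ G.controller}, ∑ a ∈ G.enabled s, (ψ s a : ℝ) / ε⌉₊)
    (by positivity) (by
      have h := (Nat.le_ceil (∑ s : {s // s ∈ G.controller}, ∑ a ∈ G.enabled s,
        (ψ s a : ℝ) / ε)).trans (Nat.cast_le.2 (le_max_right 1 _))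
      simp only [← Finset.sum_div] at h ⊢
      rwa [div_le_iff₀ hε] at h)
  refine ⟨fun τ => ?_, hsta⟩
  cases τ with
  | sta => exact ⟨_, hsta⟩
  | dyn => exact G.exists_sound_dynamic r b hfin ψ hθ hε
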